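/- Let $(X,\omega)$ be a compact Hermitian manifold with $\dim_{\mathbb C}X=n$, let $h>0$ be a constant and let $k\in\{0,\dots,2n\}$. Let $C^\infty_k(X,\mathbb C)$ be the space of smooth complex-valued $k$-forms on $X$, let $\langle\cdot,\cdot\rangle_\omega$ be the pointwise inner product on forms defined by $\omega$, and set $dV_\omega=\omega^n/n!$ and $\langle\langle u,v\rangle\rangle_\omega=\int_X\langle u,v\rangle_\omega\,dV_\omega$. Let $\theta_h$ be the linear automorphism of the bundle of $k$-forms which is the multiplication by $h^p$ on forms of type $(p,q)$. Let $\langle u,v\rangle_{\omega_h}:=h^{2p}\langle u,v\rangle_\omega$ for forms $u,v$ of type $(p,q)$, with forms of different types being orthogonal, let $dV_{\omega_h}:=h^{-2n}\,dV_\omega$ (the volume form of the metric $h^{-2}\omega$ on $T^{1,0}X$), and let $\langle\langle u,v\rangle\rangle_{\omega_h}:=\int_X\langle u,v\rangle_{\omega_h}\,dV_{\omega_h}$. Put $d_h:=h\,\partial+\bar\partial$ and consider the following operators on $C^\infty_k(X,\mathbb C)$: $$\Delta_h:=d_hd_h^\star+d_h^\star d_h,\qquad \Delta_{\omega_h}:=d\,d^\star_{\omega_h}+d^\star_{\omega_h}d,$$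 where $d_h^\star$ is the formal adjoint of $d_h$ with respect to $\langle\langle\cdot,\cdot\rangle\rangle_\omega$ and $d^\star_{\omega_h}$ is the formal adjoint of $d$ with respect to $\langle\langle\cdot,\cdot\rangle\rangle_{\omega_h}$. Then $\theta_h$ is an isometry from $\langle\cdot,\cdot\rangle_{\omega_h}$ to $\langle\cdot,\cdot\rangle_\omega$, i.e. $\langle u,v\rangle_{\omega_h}=\langle\theta_hu,\theta_hv\rangle_\omega$ for all $k$-forms $u,v$, and $$\Delta_h=\theta_h\,\Delta_{\omega_h}\,\theta_h^{-1}.$$ Consequently $\mathrm{Spec}(\Delta_h)=\mathrm{Spec}(\Delta_{\omega_h})$, the operators $\Delta_h$ and $\Delta_{\omega_h}$ have the same eigenvalues, and for every $\lambda$ their eigenspaces satisfy $$\theta_h\big(E_{\Delta_{\omega_h}}(\lambda)\big)=E_{\Delta_h}(\lambda).$$ In particular, $\Delta_h$ and $\Delta_{\omega_h}$ have the same eigenvalues with the same multiplicities. -/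

import Mathlib

open scoped Manifold ContDiff ComplexConjugate

namespace RescaledLaplacian

noncomputable section

/-! ### Linear algebra of complex-valued real forms on `ℂⁿ` -/

/-- The model space `ℂⁿ`. -/
abbrev Cn (n : ℕ) : Type := EuclideanSpace ℂ (Fin n)

/-- `Λᵏ(ℂⁿ)^* ⊗ ℂ`: complex-valued alternating `ℝ`-multilinear `k`-forms on `ℂⁿ`. -/
abbrev AltForm (n k : ℕ) : Type := Cn n [⋀^Fin k]→L[ℝ] ℂ

/-- `u` is of type `(p, q)`, i.e. `u` lies in the span of the `dz_I ∧ dz̄_J` with `|I| = p` and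
`|J| = q`. This is expressed through the action of scalars: multiplying all the arguments by `ζ`
multiplies `u` by `ζ ^ p * ζ̄ ^ q`. -/
def IsOfType {n k : ℕ} (p q : ℕ) (u : AltForm n k) : Prop :=
  ∀ (ζ : ℂ) (v : Fin k → Cn n), u (fun i => ζ • v i) = ζ ^ p * conj ζ ^ q * u v

/-- The pull-back of a form under the multiplication by `ζ` on `ℂⁿ`. -/
def rot {n k : ℕ} (ζ : ℂ) (u : AltForm n k) : AltForm n k :=
  u.compContinuousLinearMap (ζ • ContinuousLinearMap.id ℝ (Cn n))

/-- The points `exp (π i j / (k + 1))` of the unit circle. -/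
def circlePt (k j : ℕ) : ℂ := Complex.exp (Real.pi * Complex.I * j / (k + 1))

/-- The projection `u ↦ u^{p,q}`, `q = k - p`, of `k`-forms onto their component of type `(p, q)`,
written as a Fourier average over finitely many rotations. The lemmas `isOfType_typeProj`,
`sum_typeProj` and `typeProj_of_isOfType` below show that these are the projections of the
decomposition of `k`-forms into their components of pure type. -/
def typeProj {n k : ℕ} (p : ℕ) (u : AltForm n k) : AltForm n k :=
  if p ≤ k then
    ((k : ℂ) + 1)⁻¹ • ∑ j ∈ Finset.range (k + 1),
      (circlePt k j ^ p * conj (circlePt k j) ^ (k - p))⁻¹ • rot (circlePt k j) u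
  else 0

theorem rot_apply {n k : ℕ} (ζ : ℂ) (u : AltForm n k) (v : Fin k → Cn n) :
    rot ζ u v = u (fun i => ζ • v i) := rfl

theorem circlePt_ne_zero (k j : ℕ) : circlePt k j ≠ 0 := Complex.exp_ne_zero _

theorem conj_circlePt (k j : ℕ) : conj (circlePt k j) = (circlePt k j)⁻¹ := by
  unfold circlePt
  rw [← Complex.exp_conj, ← Complex.exp_neg]
  congr 1
  simp [neg_div]

theorem circlePt_character {k p j : ℕ} (hp : p ≤ k) :
    circlePt k j ^ p * conj (circlePt k j) ^ (k - p)
      = (circlePt k j ^ 2) ^ p * (circlePt k j ^ k)⁻¹ := by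
  have h0 := circlePt_ne_zero k j
  obtain ⟨q, rfl⟩ := Nat.exists_eq_add_of_le hp
  rw [conj_circlePt, Nat.add_sub_cancel_left, inv_pow]
  field_simp
  ring

theorem circlePt_sum {k p p' : ℕ} (hp : p ≤ k) (hp' : p' ≤ k) :
    ∑ j ∈ Finset.range (k + 1), (circlePt k j ^ p * conj (circlePt k j) ^ (k - p))⁻¹ *
      (circlePt k j ^ p' * conj (circlePt k j) ^ (k - p')) = if p = p' then (k : ℂ) + 1 else 0 := by
  have hk : ((k : ℂ) + 1) ≠ 0 := by exact_mod_cast Nat.succ_ne_zero k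
  set η : ℂ := Complex.exp (2 * Real.pi * Complex.I / ((k + 1 : ℕ) : ℂ)) with hη
  have hprim : IsPrimitiveRoot η (k + 1) := Complex.isPrimitiveRoot_exp _ (Nat.succ_ne_zero k)
  have hη0 : η ≠ 0 := Complex.exp_ne_zero _
  have hsq : ∀ j, circlePt k j ^ 2 = η ^ j := by
    intro j
    rw [circlePt, hη, ← Complex.exp_nat_mul, ← Complex.exp_nat_mul]
    congr 1
    push_cast
    field_simp
  have hterm : ∀ j ∈ Finset.range (k + 1),
      (circlePt k j ^ p * conj (circlePt k j) ^ (k - p))⁻¹ *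
      (circlePt k j ^ p' * conj (circlePt k j) ^ (k - p')) = ((η ^ p)⁻¹ * η ^ p') ^ j := by
    intro j _
    rw [circlePt_character hp, circlePt_character hp', hsq]
    have h0 := circlePt_ne_zero k j
    rw [mul_pow, inv_pow, ← pow_mul, ← pow_mul, ← pow_mul, ← pow_mul, mul_comm p, mul_comm p']
    field_simp
  rw [Finset.sum_congr rfl hterm]
  split_ifs with h
  · subst h
    simp [hη0]
  · have hμ : (η ^ p)⁻¹ * η ^ p' ≠ 1 := by
      intro h1
      apply h
      refine hprim.pow_inj (by omega) (by omega) ?_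
      field_simp at h1
      exact h1.symm
    have hpow : ((η ^ p)⁻¹ * η ^ p') ^ (k + 1) = 1 := by
      rw [mul_pow, inv_pow, ← pow_mul, ← pow_mul, mul_comm p, mul_comm p', pow_mul, pow_mul,
        hprim.pow_eq_one]
      simp
    rw [geom_sum_eq hμ, hpow]
    simp

theorem exists_coeff {n k : ℕ} (u : AltForm n k) (v : Fin k → Cn n) :
    ∃ c : ℕ → ℂ, ∀ ζ : ℂ, u (fun i => ζ • v i)
      = ∑ p ∈ Finset.range (k + 1), ζ ^ p * conj ζ ^ (k - p) * c p := by
  classical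
  let α : Finset (Fin k) → Fin k → ℂ := fun s i => if i ∈ s then 1 / 2 else 1 / (2 * Complex.I)
  let β : Finset (Fin k) → Fin k → ℂ := fun s i => if i ∈ s then 1 / 2 else -1 / (2 * Complex.I)
  let w : Finset (Fin k) → ℂ := fun s => u (s.piecewise v (fun i => Complex.I • v i))
  refine ⟨fun p => ∑ s : Finset (Fin k), ∑ t : Finset (Fin k),
    if t.card = p then (∏ i ∈ t, α s i) * (∏ i ∈ Finset.univ \ t, β s i) * w s else 0, ?_⟩
  intro ζ
  have h1 : (fun i => ζ • v i)
      = (fun i => ζ.re • v i) + (fun i => ζ.im • (Complex.I • v i)) := by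
    funext i
    rw [Pi.add_apply, ← Complex.coe_smul, ← Complex.coe_smul, smul_smul, ← add_smul,
      Complex.re_add_im]
  have h2 : u (fun i => ζ • v i) = ∑ s : Finset (Fin k),
      (∏ i, (α s i * ζ + β s i * conj ζ)) * w s := by
    rw [h1]
    have := u.toMultilinearMap.map_add_univ (fun i => ζ.re • v i)
      (fun i => ζ.im • (Complex.I • v i))
    refine this.trans (Finset.sum_congr rfl fun s _ => ?_)
    have h3 : s.piecewise (fun i => ζ.re • v i) (fun i => ζ.im • (Complex.I • v i))
        = fun i => (if i ∈ s then ζ.re else ζ.im) • (s.piecewise v (fun i => Complex.I • v i)) i := by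
      funext i
      by_cases hi : i ∈ s <;> simp [Finset.piecewise, hi]
    rw [h3]
    have h4 := u.toMultilinearMap.map_smul_univ (fun i => if i ∈ s then ζ.re else ζ.im)
      (s.piecewise v (fun i => Complex.I • v i))
    refine h4.trans ?_
    have h5 : (∏ i, (α s i * ζ + β s i * conj ζ))
        = ((∏ i, (if i ∈ s then ζ.re else ζ.im) : ℝ) : ℂ) := by
      rw [Complex.ofReal_prod]
      refine Finset.prod_congr rfl fun i _ => ?_
      by_cases hi : i ∈ s
      · simp only [α, β, hi, if_true, Complex.re_eq_add_conj]
        ring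
      · simp only [α, β, hi, if_false, Complex.im_eq_sub_conj]
        ring
    rw [h5, Complex.real_smul]
    rfl
  rw [h2]
  simp_rw [Finset.mul_sum]
  rw [Finset.sum_comm]
  refine Finset.sum_congr rfl fun s _ => ?_
  rw [Finset.prod_add, Finset.sum_mul, Finset.sum_comm, Finset.powerset_univ]
  refine Finset.sum_congr rfl fun t _ => ?_
  have hc : t.card ∈ Finset.range (k + 1) := by
    have := t.card_le_univ
    rw [Fintype.card_fin] at this
    exact Finset.mem_range.2 (by omega)
  rw [Finset.sum_eq_single_of_mem _ hc (fun p _ hp => by rw [if_neg (Ne.symm hp), mul_zero]),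
    if_pos rfl, Finset.prod_mul_distrib, Finset.prod_mul_distrib, Finset.prod_const,
    Finset.prod_const, Finset.card_sdiff_of_subset (Finset.subset_univ t), Finset.card_univ,
    Fintype.card_fin]
  ring

theorem typeProj_apply {n k p : ℕ} (hp : p ≤ k) (u : AltForm n k) (v : Fin k → Cn n) (c : ℕ → ℂ)
    (hc : ∀ ζ : ℂ, u (fun i => ζ • v i)
      = ∑ p ∈ Finset.range (k + 1), ζ ^ p * conj ζ ^ (k - p) * c p) :
    typeProj p u v = c p := by
  have hk : ((k : ℂ) + 1) ≠ 0 := by exact_mod_cast Nat.succ_ne_zero k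
  have h1 : typeProj p u v = ((k : ℂ) + 1)⁻¹ * ∑ j ∈ Finset.range (k + 1),
      (circlePt k j ^ p * conj (circlePt k j) ^ (k - p))⁻¹ * rot (circlePt k j) u v := by
    rw [typeProj, if_pos hp]
    simp
  rw [h1]
  simp_rw [rot_apply, hc, Finset.mul_sum]
  rw [Finset.sum_comm, Finset.sum_eq_single p]
  · have := circlePt_sum hp hp
    rw [if_pos rfl] at this
    simp_rw [← mul_assoc]
    rw [← Finset.sum_mul]
    simp_rw [mul_assoc]
    rw [← Finset.mul_sum, this]
    field_simp
  · intro p' hp' hne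
    have := circlePt_sum hp (Nat.lt_succ_iff.1 (Finset.mem_range.1 hp'))
    rw [if_neg (Ne.symm hne)] at this
    simp_rw [← mul_assoc]
    rw [← Finset.sum_mul]
    simp_rw [mul_assoc]
    rw [← Finset.mul_sum, this]
    simp
  · intro h
    exact absurd (Finset.mem_range.2 (Nat.lt_succ_of_le hp)) h

/-- `u^{p,q}` is of type `(p, q)`. -/
theorem isOfType_typeProj {n k p : ℕ} (hp : p ≤ k) (u : AltForm n k) :
    IsOfType p (k - p) (typeProj p u) := by
  intro ξ v
  obtain ⟨c, hc⟩ := exists_coeff u v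
  rw [typeProj_apply hp u v c hc]
  refine typeProj_apply hp u _ (fun p => ξ ^ p * conj ξ ^ (k - p) * c p) fun ζ => ?_
  have := hc (ζ * ξ)
  simp_rw [mul_smul] at this
  rw [this]
  refine Finset.sum_congr rfl fun p _ => ?_
  rw [map_mul, mul_pow, mul_pow]
  ring

/-- `u = ∑ u^{p,q}`. -/
theorem sum_typeProj {n k : ℕ} (u : AltForm n k) :
    ∑ p ∈ Finset.range (k + 1), typeProj p u = u := by
  ext v
  obtain ⟨c, hc⟩ := exists_coeff u v
  have h1 := hc 1
  simp only [one_smul, one_pow, map_one, one_mul] at h1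
  rw [h1, ContinuousAlternatingMap.sum_apply]
  exact Finset.sum_congr rfl fun p hp =>
    typeProj_apply (Nat.lt_succ_iff.1 (Finset.mem_range.1 hp)) u v c hc

/-- If `u` is of type `(p', q')`, then `u^{p',q'} = u` and the other components vanish. -/
theorem typeProj_of_isOfType {n k p p' : ℕ} (hp : p ≤ k) (hp' : p' ≤ k) (u : AltForm n k)
    (hu : IsOfType p' (k - p') u) : typeProj p u = if p = p' then u else 0 := by
  ext v
  rw [typeProj_apply hp u v (fun r => if r = p' then u v else 0)]
  · split_ifs <;> rfl
  · intro ζ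
    rw [hu ζ v, Finset.sum_eq_single_of_mem p' (Finset.mem_range.2 (Nat.lt_succ_of_le hp'))
      (fun r _ hr => by rw [if_neg hr, mul_zero]), if_pos rfl]

theorem typeProj_typeProj {n k p p' : ℕ} (hp : p ≤ k) (hp' : p' ≤ k) (u : AltForm n k) :
    typeProj p (typeProj p' u) = if p = p' then typeProj p' u else 0 :=
  typeProj_of_isOfType hp hp' _ (isOfType_typeProj hp' u)

theorem rot_add {n k : ℕ} (ζ : ℂ) (u v : AltForm n k) : rot ζ (u + v) = rot ζ u + rot ζ v := rfl

theorem rot_smul {n k : ℕ} (ζ a : ℂ) (u : AltForm n k) : rot ζ (a • u) = a • rot ζ u := rfl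

theorem typeProj_add {n k : ℕ} (p : ℕ) (u v : AltForm n k) :
    typeProj p (u + v) = typeProj p u + typeProj p v := by
  unfold typeProj
  split_ifs
  · simp only [rot_add, smul_add, Finset.sum_add_distrib]
  · simp

theorem typeProj_smul {n k : ℕ} (p : ℕ) (a : ℂ) (u : AltForm n k) :
    typeProj p (a • u) = a • typeProj p u := by
  unfold typeProj
  split_ifs
  · simp only [rot_smul, Finset.smul_sum]
    exact Finset.sum_congr rfl fun j _ => by
      rw [smul_smul, smul_smul, smul_smul, smul_smul]
      congr 1
      ring
  · exact (smul_zero (A := AltForm n k) a).symm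

theorem contDiff_typeProj {n k : ℕ} (p : ℕ) : ContDiff ℝ ∞ (typeProj (n := n) (k := k) p) := by
  unfold typeProj
  split_ifs
  · refine ContDiff.const_smul _ (ContDiff.sum fun j _ => ContDiff.const_smul _ ?_)
    exact (ContinuousAlternatingMap.compContinuousLinearMapCLM (F := ℂ) (ι := Fin k)
      (circlePt k j • ContinuousLinearMap.id ℝ (Cn n))).contDiff
  · exact contDiff_const

theorem typeProj_comp {n k : ℕ} (p : ℕ) (u : AltForm n k) (A : Cn n →L[ℂ] Cn n) :
    typeProj p (u.compContinuousLinearMap (A.restrictScalars ℝ))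
      = (typeProj p u).compContinuousLinearMap (A.restrictScalars ℝ) := by
  unfold typeProj
  split_ifs
  · ext v
    simp [rot_apply, Function.comp_def]
  · rfl

/-! ### Smooth forms on a complex manifold -/

/-- A complex manifold is a smooth real manifold. -/
instance realSmooth {n : ℕ} (X : Type*) [TopologicalSpace X] [ChartedSpace (Cn n) X]
    [IsManifold 𝓘(ℂ, Cn n) ω X] : IsManifold 𝓘(ℝ, Cn n) ∞ X := by
  apply isManifold_of_contDiffOn
  intro e e' he he'
  have := (contDiffGroupoid ω 𝓘(ℂ, Cn n)).compatible he he'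
  rw [contDiffGroupoid, mem_groupoid_of_pregroupoid, contDiffPregroupoid] at this
  have h1 := this.1
  simp at h1
  simp
  exact (h1.restrict_scalars ℝ).of_le (by simp)

section Forms

variable {n : ℕ} {X : Type*} [TopologicalSpace X] [ChartedSpace (Cn n) X]
  [IsManifold 𝓘(ℂ, Cn n) ω X]

/-- The expression in the chart at `c` of a `k`-form `u`. As everywhere in Mathlib, `T_xX` is the
model space `ℂⁿ`, identified through the preferred chart at `x`. So the expression of `u` in the
chart at `c` is the pull-back of the values of `u` by the tangent coordinate changes. -/
def localRep {k : ℕ} (u : X → AltForm n k) (c : X) (y : Cn n) : AltForm n k :=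
  (u ((chartAt (Cn n) c).symm y)).compContinuousLinearMap
    ((tangentCoordChange 𝓘(ℂ, Cn n) c ((chartAt (Cn n) c).symm y)
      ((chartAt (Cn n) c).symm y)).restrictScalars ℝ)

variable (n X) in
/-- `C^∞_k(X, ℂ)`: the space of (real-)smooth complex-valued `k`-forms on `X`. -/
def Form (k : ℕ) : Submodule ℂ (X → AltForm n k) where
  carrier := {u | ∀ c : X, ContDiffOn ℝ ∞ (localRep u c) (chartAt (Cn n) c).target}
  add_mem' := fun hu hv c => (hu c).add (hv c)
  zero_mem' := fun _ => contDiffOn_const (c := 0)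
  smul_mem' := fun a _ hu c => (hu c).const_smul a

instance (k : ℕ) : AddCommGroup (Form n X k) := Submodule.addCommGroup _

/-- `u ↦ u^{p,q}`, `q = k - p`, on smooth `k`-forms. -/
def component {k : ℕ} (p : ℕ) : Form n X k →ₗ[ℂ] Form n X k where
  toFun u := ⟨fun x => typeProj p (u.1 x), fun c => by
    have : localRep (fun x => typeProj p (u.1 x)) c = typeProj p ∘ localRep u.1 c := by
      funext y
      exact (typeProj_comp p _ _).symm
    rw [this]
    exact (contDiff_typeProj p).comp_contDiffOn (u.2 c)⟩
  map_add' u v := Subtype.ext (funext fun x => typeProj_add p _ _)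
  map_smul' a u := Subtype.ext (funext fun x => typeProj_smul p a _)

/-- The exterior derivative at `x`, computed in the preferred chart at `x`; by
`localRep_extD` it is computed by the same formula in every chart. -/
def extD {k : ℕ} (u : X → AltForm n k) (x : X) : AltForm n (k + 1) :=
  extDeriv (localRep u x) (chartAt (Cn n) x x)

theorem localRep_extD {k : ℕ} (u : Form n X k) (c : X) {y : Cn n}
    (hy : y ∈ (chartAt (Cn n) c).target) :
    localRep (extD u.1) c y = extDeriv (localRep u.1 c) y := by
  set x := (chartAt (Cn n) c).symm y with hx
  have hxc : x ∈ (chartAt (Cn n) c).source := (chartAt (Cn n) c).map_target hy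
  set τ : Cn n → Cn n := chartAt (Cn n) x ∘ (chartAt (Cn n) c).symm with hτ
  set U : Set (Cn n) := (chartAt (Cn n) c).target ∩
    (chartAt (Cn n) c).symm ⁻¹' (chartAt (Cn n) x).source with hU
  have hUo : IsOpen U :=
    (chartAt (Cn n) c).isOpen_inter_preimage_symm (chartAt (Cn n) x).open_source
  have hyU : y ∈ U := ⟨hy, mem_chart_source _ x⟩
  have hgr := (contDiffGroupoid ω 𝓘(ℂ, Cn n)).compatible
    (chart_mem_atlas (Cn n) c) (chart_mem_atlas (Cn n) x)
  rw [contDiffGroupoid, mem_groupoid_of_pregroupoid, contDiffPregroupoid] at hgr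
  have hτC : ContDiffOn ℂ ω τ U := by
    have h1 := hgr.1
    simp at h1
    exact h1
  have hτR : ContDiffOn ℝ ω τ U := hτC.restrict_scalars ℝ
  have hder : ∀ y' ∈ U, fderiv ℝ τ y' = (tangentCoordChange 𝓘(ℂ, Cn n) c x
      ((chartAt (Cn n) c).symm y')).restrictScalars ℝ := by
    intro y' hy'
    have hd : DifferentiableAt ℂ τ y' :=
      (hτC.contDiffAt (hUo.mem_nhds hy')).differentiableAt (by simp)
    rw [hd.fderiv_restrictScalars ℝ, tangentCoordChange_def]
    simp [(chartAt (Cn n) c).right_inv hy'.1, hτ]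
  have hloc : ∀ y' ∈ U, localRep u.1 c y'
      = (localRep u.1 x (τ y')).compContinuousLinearMap (fderiv ℝ τ y') := by
    intro y' hy'
    rw [hder y' hy']
    have hz : (chartAt (Cn n) x).symm (τ y') = (chartAt (Cn n) c).symm y' :=
      (chartAt (Cn n) x).left_inv hy'.2
    unfold localRep
    rw [hz]
    ext v
    simp only [ContinuousAlternatingMap.compContinuousLinearMap_apply]
    congr 1
    funext i
    refine (tangentCoordChange_comp ?_).symm
    simp only [extChartAt_source]
    exact ⟨⟨(chartAt (Cn n) c).map_target hy'.1, hy'.2⟩, mem_chart_source _ _⟩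
  have hev : localRep u.1 c =ᶠ[nhds y]
      fun y' => (localRep u.1 x (τ y')).compContinuousLinearMap (fderiv ℝ τ y') :=
    Filter.eventually_of_mem (hUo.mem_nhds hyU) hloc
  have hτy : τ y = chartAt (Cn n) x x := by simp [hτ, hx]
  have hdiff : DifferentiableAt ℝ (localRep u.1 x) (τ y) := by
    rw [hτy]
    exact ((u.2 x).contDiffAt ((chartAt (Cn n) x).open_target.mem_nhds
      (mem_chart_target _ x))).differentiableAt (by simp)
  rw [hev.extDeriv_eq, extDeriv_pullback hdiff (hτR.contDiffAt (hUo.mem_nhds hyU)) (by simp),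
    hder y hyU, hτy]
  rfl

/-- The exterior derivative `d : C^∞_k(X, ℂ) → C^∞_{k+1}(X, ℂ)`. -/
def d (k : ℕ) : Form n X k →ₗ[ℂ] Form n X (k + 1) where
  toFun u := ⟨extD u.1, fun c => by
    have h1 : ContDiffOn ℝ ∞ (fderiv ℝ (localRep u.1 c)) (chartAt (Cn n) c).target :=
      (u.2 c).fderiv_of_isOpen (chartAt (Cn n) c).open_target (by simp)
    have h2 : ContDiffOn ℝ ∞ (extDeriv (localRep u.1 c)) (chartAt (Cn n) c).target :=
      ((ContinuousAlternatingMap.alternatizeUncurryFinCLM ℝ (Cn n) ℂ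
        (n := k)).contDiff.comp_contDiffOn h1).congr fun y _ => by simp [extDeriv]
    exact h2.congr fun y hy => localRep_extD u c hy⟩
  map_add' u v := Subtype.ext (funext fun x => by
    have h : ∀ w : Form n X k, DifferentiableAt ℝ (localRep w.1 x) (chartAt (Cn n) x x) :=
      fun w => ((w.2 x).contDiffAt ((chartAt (Cn n) x).open_target.mem_nhds
        (mem_chart_target _ x))).differentiableAt (by simp)
    exact extDeriv_add (h u) (h v))
  map_smul' a u := Subtype.ext (funext fun x => by
    have h : DifferentiableAt ℝ (localRep u.1 x) (chartAt (Cn n) x x) :=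
      ((u.2 x).contDiffAt ((chartAt (Cn n) x).open_target.mem_nhds
        (mem_chart_target _ x))).differentiableAt (by simp)
    have h1 : localRep (a • u).1 x = a • localRep u.1 x := rfl
    change extDeriv (localRep (a • u).1 x) _ = a • extDeriv (localRep u.1 x) _
    rw [h1]
    ext v
    simp [extDeriv, fderiv_const_smul h, ContinuousAlternatingMap.alternatizeUncurryFin_apply,
      Finset.mul_sum])

/-- `∂`, which maps a form `u` of type `(p, q)` to the component of type `(p + 1, q)` of `du`. -/
def del (k : ℕ) : Form n X k →ₗ[ℂ] Form n X (k + 1) :=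
  ∑ p ∈ Finset.range (k + 1), component (p + 1) ∘ₗ d k ∘ₗ component p

/-- `∂̄`, which maps a form `u` of type `(p, q)` to the component of type `(p, q + 1)` of `du`. -/
def delbar (k : ℕ) : Form n X k →ₗ[ℂ] Form n X (k + 1) :=
  ∑ p ∈ Finset.range (k + 1), component p ∘ₗ d k ∘ₗ component p

/-- `d_h = h ∂ + ∂̄`. -/
def dh (h : ℝ) (k : ℕ) : Form n X k →ₗ[ℂ] Form n X (k + 1) :=
  (h : ℂ) • del k + delbar k

/-- `θ_h`, the multiplication by `h ^ p` on forms of type `(p, q)`. -/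
def thetaMap (h : ℝ) (k : ℕ) : Form n X k →ₗ[ℂ] Form n X k :=
  ∑ p ∈ Finset.range (k + 1), ((h : ℂ) ^ p) • component p

theorem thetaMap_thetaMap {h h' : ℝ} (hh : h * h' = 1) (k : ℕ) (u : Form n X k) :
    thetaMap h k (thetaMap h' k u) = u := by
  have hc : (h : ℂ) * h' = 1 := by exact_mod_cast hh
  refine Subtype.ext (funext fun x => ?_)
  have key : ∀ p ∈ Finset.range (k + 1), component p (thetaMap h' k u)
      = ((h' : ℂ) ^ p) • component p u := by
    intro p hp
    have hp1 := Nat.lt_succ_iff.1 (Finset.mem_range.1 hp)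
    rw [thetaMap, LinearMap.sum_apply, map_sum, Finset.sum_eq_single_of_mem p hp]
    · rw [LinearMap.smul_apply, map_smul]
      congr 1
      refine Subtype.ext (funext fun x => ?_)
      exact (typeProj_typeProj hp1 hp1 _).trans (if_pos rfl)
    · intro p' hp' hne
      rw [LinearMap.smul_apply, map_smul]
      have : component p (component p' u) = 0 := by
        refine Subtype.ext (funext fun x => ?_)
        exact (typeProj_typeProj hp1 (Nat.lt_succ_iff.1 (Finset.mem_range.1 hp')) _).trans
          (if_neg (Ne.symm hne))
      rw [this, smul_zero]
  have h1 : thetaMap h k (thetaMap h' k u) = ∑ p ∈ Finset.range (k + 1), component p u := by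
    conv_lhs => rw [thetaMap, LinearMap.sum_apply]
    refine Finset.sum_congr rfl fun p hp => ?_
    rw [LinearMap.smul_apply, key p hp, smul_smul, ← mul_pow, hc, one_pow, one_smul]
  rw [h1]
  refine Eq.trans ?_ (sum_typeProj (u.1 x))
  rw [AddSubmonoidClass.coe_finsetSum, Finset.sum_apply]
  rfl

/-- `θ_h` as a linear automorphism of `C^∞_k(X, ℂ)`, for `h > 0`. -/
def theta {h : ℝ} (hh : 0 < h) (k : ℕ) : Form n X k ≃ₗ[ℂ] Form n X k :=
  LinearEquiv.ofLinearMap (thetaMap h k) (thetaMap h⁻¹ k)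
    (LinearMap.ext fun u => thetaMap_thetaMap (mul_inv_cancel₀ hh.ne') k u)
    (LinearMap.ext fun u => thetaMap_thetaMap (inv_mul_cancel₀ hh.ne') k u)

/-! ### Hermitian metrics and the associated inner products -/

variable (n X) in
/-- A smooth Hermitian metric `ω` on the complex manifold `X`, given by its real part: a smooth
Riemannian metric for which the multiplication by `i` on the tangent spaces is an isometry. -/
structure HermitianMetric extends Bundle.ContMDiffRiemannianMetric 𝓘(ℝ, Cn n) ∞ (Cn n)
    (fun x : X => TangentSpace 𝓘(ℝ, Cn n) x) where
  inner_I_smul : ∀ (x : X) (v w : Cn n),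
    inner x (Complex.I • v : Cn n) (Complex.I • w : Cn n) = inner x v w

/-- A field of real bilinear forms on the tangent spaces. -/
abbrev BilinField (n : ℕ) (X : Type*) : Type _ := X → Cn n →L[ℝ] Cn n →L[ℝ] ℝ

/-- The Riemannian metric underlying a Hermitian metric. -/
def HermitianMetric.bilin (g : HermitianMetric n X) : BilinField n X := g.inner

variable (n) in
/-- A real orthonormal basis of the model space `ℂⁿ`. -/
abbrev realBasis : OrthonormalBasis (Fin (Module.finrank ℝ (Cn n))) ℝ (Cn n) :=
  stdOrthonormalBasis ℝ (Cn n)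

/-- The Gram matrix of a real bilinear form on `ℂⁿ`. -/
def gram (B : Cn n →L[ℝ] Cn n →L[ℝ] ℝ) :
    Matrix (Fin (Module.finrank ℝ (Cn n))) (Fin (Module.finrank ℝ (Cn n))) ℝ :=
  Matrix.of fun i j => B (realBasis n i) (realBasis n j)

/-- The Hermitian inner product on `k`-forms induced by the inner product `B` on the tangent space:
`⟨u, v⟩ = (1 / k!) ∑ g^{i₁j₁} ⋯ g^{i_kj_k} u_{i₁…i_k} conj v_{j₁…j_k}`, where `(g^{ij})` is the
inverse of the Gram matrix. -/
def formInner {k : ℕ} (B : Cn n →L[ℝ] Cn n →L[ℝ] ℝ) (u v : AltForm n k) : ℂ :=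
  ((k.factorial : ℂ))⁻¹ * ∑ I : Fin k → Fin (Module.finrank ℝ (Cn n)),
    ∑ J : Fin k → Fin (Module.finrank ℝ (Cn n)),
      (∏ a, (((gram B)⁻¹ (I a) (J a) : ℝ) : ℂ)) *
        u (fun a => realBasis n (I a)) * conj (v (fun a => realBasis n (J a)))

/-- The pointwise inner product `⟨u, v⟩_{ω_h} = h ^ (2 p) ⟨u, v⟩_ω` on forms of type `(p, q)`,
extended to `k`-forms by making forms of different types orthogonal. -/
def formInnerRescaled {k : ℕ} (B : Cn n →L[ℝ] Cn n →L[ℝ] ℝ) (h : ℝ) (u v : AltForm n k) : ℂ :=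
  ∑ p ∈ Finset.range (k + 1), (h : ℂ) ^ (2 * p) * formInner B (typeProj p u) (typeProj p v)

/-- The expression in the chart at `c` of a field of bilinear forms on the tangent spaces. -/
def localBilin (b : BilinField n X) (c : X) (y : Cn n) : Cn n →L[ℝ] Cn n →L[ℝ] ℝ :=
  (b ((chartAt (Cn n) c).symm y)).bilinearComp
    ((tangentCoordChange 𝓘(ℂ, Cn n) c ((chartAt (Cn n) c).symm y)
      ((chartAt (Cn n) c).symm y)).restrictScalars ℝ)
    ((tangentCoordChange 𝓘(ℂ, Cn n) c ((chartAt (Cn n) c).symm y)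
      ((chartAt (Cn n) c).symm y)).restrictScalars ℝ)

/-- The density `√(det g_{ij})`, in the chart at `c`, of the volume element of the Riemannian metric
`b` with respect to the Lebesgue measure. If `b` is the real part of a Hermitian metric `ω`, this
volume element is `dV_ω = ω^n / n!`. -/
def volDensity (b : BilinField n X) (c : X) (y : Cn n) : ℝ :=
  Real.sqrt (gram (localBilin b c y)).det

section Integration

variable [T2Space X] [CompactSpace X]

variable (n X) in
/-- A smooth partition of unity on `X` subordinate to the charts. -/
def partition : SmoothPartitionOfUnity X 𝓘(ℝ, Cn n) X Set.univ :=
  Classical.choose (SmoothPartitionOfUnity.exists_isSubordinate_chartAt_source 𝓘(ℝ, Cn n) X)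

/-- `∫_X f dV` for the volume element of the metric `b`, computed in charts through a partition of
unity subordinate to the charts. (Only finitely many terms of the sum do not vanish.) -/
def integral (b : BilinField n X) (f : X → ℂ) : ℂ :=
  ∑ᶠ c : X, ∫ y in (chartAt (Cn n) c).target,
    ((partition n X c ((chartAt (Cn n) c).symm y) * volDensity b c y : ℝ) : ℂ) *
      f ((chartAt (Cn n) c).symm y)

/-- The `L²` inner product `⟨⟨u, v⟩⟩_ω = ∫_X ⟨u, v⟩_ω dV_ω`. -/
def innerL2 (g : HermitianMetric n X) {k : ℕ} (u v : Form n X k) : ℂ :=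
  integral g.bilin fun x => formInner (g.bilin x) (u.1 x) (v.1 x)

/-- The `L²` inner product `⟨⟨u, v⟩⟩_{ω_h} = ∫_X ⟨u, v⟩_{ω_h} dV_{ω_h}`, where `dV_{ω_h}` is the
volume element of the rescaled metric `h⁻² ω` on the tangent spaces. -/
def innerL2Rescaled (g : HermitianMetric n X) (h : ℝ) {k : ℕ} (u v : Form n X k) : ℂ :=
  integral (fun x => (h ^ 2)⁻¹ • g.bilin x) fun x => formInnerRescaled (g.bilin x) h (u.1 x) (v.1 x)

end Integration

end Forms

/-! ### Formal adjoints and Laplacians -/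

/-- `S` is a formal adjoint of `D` for the given inner products on `V` and `W`. -/
def IsFormalAdjoint {V W : Type*} [AddCommGroup V] [Module ℂ V] [AddCommGroup W] [Module ℂ W]
    (ipV : V → V → ℂ) (ipW : W → W → ℂ) (D : V →ₗ[ℂ] W) (S : W →ₗ[ℂ] V) : Prop :=
  ∀ (u : V) (v : W), ipW (D u) v = ipV u (S v)

open Classical in
/-- The formal adjoint of `D`. (For a differential operator between smooth forms on a compact
manifold, and the `L²` inner products, it exists and is unique. The value `0` stands for the case
in which there is no formal adjoint.) -/
def formalAdjoint {V W : Type*} [AddCommGroup V] [Module ℂ V] [AddCommGroup W] [Module ℂ W]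
    (ipV : V → V → ℂ) (ipW : W → W → ℂ) (D : V →ₗ[ℂ] W) : W →ₗ[ℂ] V :=
  if H : ∃ S : W →ₗ[ℂ] V, IsFormalAdjoint ipV ipW D S then Classical.choose H else 0

section Laplacians

variable {n : ℕ} {X : Type*} [TopologicalSpace X] [ChartedSpace (Cn n) X]
  [IsManifold 𝓘(ℂ, Cn n) ω X]

/-- `D D^* + D^* D` in degree `k`, for operators `D` of degree `1` and `D^*` of degree `-1`; in
degree `0` the first term is absent. -/
def hodgeLaplacian (D : ∀ k, Form n X k →ₗ[ℂ] Form n X (k + 1))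
    (S : ∀ k, Form n X (k + 1) →ₗ[ℂ] Form n X k) :
    ∀ k, Module.End ℂ (Form n X k)
  | 0 => S 0 ∘ₗ D 0
  | k + 1 => D k ∘ₗ S k + S (k + 1) ∘ₗ D (k + 1)

variable [T2Space X] [CompactSpace X]

/-- `Δ_h = d_h d_h^* + d_h^* d_h`, where `d_h^*` is the formal adjoint of `d_h` with respect to the
`L²` inner product of `ω`. -/
def laplacianH (g : HermitianMetric n X) (h : ℝ) (k : ℕ) : Module.End ℂ (Form n X k) :=
  hodgeLaplacian (dh h)
    (fun k => formalAdjoint (V := Form n X k) (W := Form n X (k + 1)) (innerL2 g) (innerL2 g) (dh h k)) k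

/-- `Δ_{ω_h} = d d^*_{ω_h} + d^*_{ω_h} d`, where `d^*_{ω_h}` is the formal adjoint of `d` with
respect to the `L²` inner product of `ω_h`. -/
def laplacianMetric (g : HermitianMetric n X) (h : ℝ) (k : ℕ) :
    Module.End ℂ (Form n X k) :=
  hodgeLaplacian d
    (fun k => formalAdjoint (V := Form n X k) (W := Form n X (k + 1)) (innerL2Rescaled g h)
      (innerL2Rescaled g h) (d k)) k

end Laplacians

end

end RescaledLaplacian

open RescaledLaplacian

/-!
The operators `d_h` and `d` are conjugate by `θ_h`, and so are their formal adjoints, because `θ_h`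
is, up to a constant factor, an isometry of the `L²` inner products. Hence the Laplacians are
conjugate, and the statements on spectra and eigenspaces are formal consequences.

* `θ_h d = d_h θ_h` (`thetaMap_d`). In holomorphic coordinates the derivative of a form of type
  `(p, q)` is the sum of a `ℂ`-linear and of a conjugate linear map with values in forms of type
  `(p, q)`, so that `du` has only components of types `(p + 1, q)` and `(p, q + 1)`
  (`typeProj_extDeriv`); `θ_h` multiplies them by `h ^ (p + 1)` and `h ^ p`.
* `θ_h` is a pointwise isometry (`formInnerRescaled_eq`) as soon as forms of different types are
  orthogonal for `⟨·, ·⟩_ω`. The unit circle acts on tangent vectors by isometries of `ω`, hence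
  unitarily on forms (`formInner_rot`), and through different characters on different types. The
  volume elements of `ω` and `h⁻² ω` differ by a constant, which gives `innerL2Rescaled_eq`.
* Formal adjoints are unique since the `L²` inner product is additive and positive definite
  (`innerL2_add_right`, `eq_zero_of_innerL2_self`). Both rest on the pointwise positivity of
  `formInner`, on its invariance under changes of frames (`formInner_comp`), by which the
  integrands are continuous functions in each chart, and on the compactness of `X`. By
  `isFormalAdjoint_iff` the formal adjoints of `d` and of `d_h` correspond to each other under `θ_h`.
-/

namespace RescaledLaplacian

noncomputable section

/-! ### Invariance and positivity of the inner product on forms -/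

/-- The contraction `∑ P^{i₁j₁} ⋯ P^{i_kj_k} u_{i₁…i_k} conj v_{j₁…j_k}` of two forms with a matrix
`P`. Up to the factor `1 / k!`, `formInner` is the case `P = (g^{ij})`. -/
def contraction {n k : ℕ}
    (P : Matrix (Fin (Module.finrank ℝ (Cn n))) (Fin (Module.finrank ℝ (Cn n))) ℝ)
    (u v : AltForm n k) : ℂ :=
  ∑ I : Fin k → Fin (Module.finrank ℝ (Cn n)), ∑ J : Fin k → Fin (Module.finrank ℝ (Cn n)),
    (∏ a, ((P (I a) (J a) : ℝ) : ℂ)) *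
      u (fun a => realBasis n (I a)) * conj (v (fun a => realBasis n (J a)))

theorem formInner_eq_contraction {n k : ℕ} (B : Cn n →L[ℝ] Cn n →L[ℝ] ℝ) (u v : AltForm n k) :
    formInner B u v = ((k.factorial : ℂ))⁻¹ * contraction (gram B)⁻¹ u v := rfl

/-- The matrix of a real endomorphism of `ℂⁿ` in the basis `realBasis n`. -/
abbrev realMatrix (n : ℕ) (A : Cn n →L[ℝ] Cn n) :
    Matrix (Fin (Module.finrank ℝ (Cn n))) (Fin (Module.finrank ℝ (Cn n))) ℝ :=
  LinearMap.toMatrix (realBasis n).toBasis (realBasis n).toBasis A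

theorem map_realBasis {n : ℕ} (A : Cn n →L[ℝ] Cn n) (i : Fin (Module.finrank ℝ (Cn n))) :
    A (realBasis n i) = ∑ j, realMatrix n A j i • realBasis n j := by
  conv_lhs => rw [← (realBasis n).toBasis.sum_repr (A (realBasis n i))]
  simp [LinearMap.toMatrix_apply]

theorem form_map_realBasis {n k : ℕ} (A : Cn n →L[ℝ] Cn n) (u : AltForm n k)
    (I : Fin k → Fin (Module.finrank ℝ (Cn n))) :
    u (fun a => A (realBasis n (I a))) = ∑ I' : Fin k → Fin (Module.finrank ℝ (Cn n)),
      (∏ a, ((realMatrix n A (I' a) (I a) : ℝ) : ℂ)) * u (fun a => realBasis n (I' a)) := by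
  simp_rw [map_realBasis A]
  refine (u.toMultilinearMap.map_sum
    (fun a j => realMatrix n A j (I a) • realBasis n j)).trans ?_
  refine Finset.sum_congr rfl fun I' _ => ?_
  refine (u.toMultilinearMap.map_smul_univ (fun a => realMatrix n A (I' a) (I a))
    (fun a => realBasis n (I' a))).trans ?_
  rw [Complex.real_smul, Complex.ofReal_prod]
  rfl

theorem contraction_comp {n k : ℕ}
    (P : Matrix (Fin (Module.finrank ℝ (Cn n))) (Fin (Module.finrank ℝ (Cn n))) ℝ)
    (A : Cn n →L[ℝ] Cn n) (u v : AltForm n k) :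
    contraction P (u.compContinuousLinearMap A) (v.compContinuousLinearMap A)
      = contraction (realMatrix n A * P * (realMatrix n A).transpose) u v := by
  set M := realMatrix n A with hM
  have hprod : ∀ I' J' : Fin k → Fin (Module.finrank ℝ (Cn n)),
      (∏ a, (((M * P * M.transpose) (I' a) (J' a) : ℝ) : ℂ))
        = ∑ J : Fin k → Fin (Module.finrank ℝ (Cn n)),
          ∑ I : Fin k → Fin (Module.finrank ℝ (Cn n)), (∏ a, ((M (I' a) (I a) : ℝ) : ℂ)) *
            (∏ a, ((P (I a) (J a) : ℝ) : ℂ)) * ∏ a, ((M (J' a) (J a) : ℝ) : ℂ) := by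
    intro I' J'
    simp_rw [Matrix.mul_apply, Matrix.transpose_apply, Complex.ofReal_sum, Complex.ofReal_mul,
      Complex.ofReal_sum, Complex.ofReal_mul]
    rw [Fintype.prod_sum]
    refine Finset.sum_congr rfl fun J _ => ?_
    rw [Finset.prod_mul_distrib, Fintype.prod_sum, Finset.sum_mul]
    refine Finset.sum_congr rfl fun I _ => ?_
    rw [Finset.prod_mul_distrib]
  unfold contraction
  simp_rw [hprod, ContinuousAlternatingMap.compContinuousLinearMap_apply, Function.comp_def,
    form_map_realBasis A, map_sum, map_mul, map_prod, Complex.conj_ofReal, Finset.mul_sum,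
    Finset.sum_mul, ← hM]
  -- both sides are sums over four multi-indices
  calc _ = ∑ I : Fin k → Fin (Module.finrank ℝ (Cn n)),
        ∑ J : Fin k → Fin (Module.finrank ℝ (Cn n)), ∑ I' : Fin k → Fin (Module.finrank ℝ (Cn n)),
        ∑ J' : Fin k → Fin (Module.finrank ℝ (Cn n)),
          (∏ a, ((M (I' a) (I a) : ℝ) : ℂ)) *
            (∏ a, ((P (I a) (J a) : ℝ) : ℂ)) * (∏ a, ((M (J' a) (J a) : ℝ) : ℂ)) *
            u (fun a => realBasis n (I' a)) * conj (v (fun a => realBasis n (J' a))) := by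
        refine Finset.sum_congr rfl fun I _ => Finset.sum_congr rfl fun J _ => ?_
        rw [Finset.sum_comm]
        refine Finset.sum_congr rfl fun I' _ => Finset.sum_congr rfl fun J' _ => ?_
        ring
    _ = _ := by
        simp_rw [← Fintype.sum_prod_type']
        let ι := Fin k → Fin (Module.finrank ℝ (Cn n))
        let e : ι × ι × ι × ι ≃ ι × ι × ι × ι :=
          ⟨fun q => (q.2.2.1, q.2.2.2, q.2.1, q.1), fun q => (q.2.2.2, q.2.2.1, q.1, q.2.1),
            fun _ => rfl, fun _ => rfl⟩
        exact Fintype.sum_equiv e _ _ fun q => rfl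

theorem gram_bilinearComp {n : ℕ} (B : Cn n →L[ℝ] Cn n →L[ℝ] ℝ) (A : Cn n →L[ℝ] Cn n) :
    gram (B.bilinearComp A A)
      = (realMatrix n A).transpose * gram B * realMatrix n A := by
  ext i j
  simp only [gram, Matrix.of_apply, ContinuousLinearMap.bilinearComp_apply, map_realBasis A,
    map_sum, map_smul, sum_apply, smul_apply,
    Matrix.mul_apply, Matrix.transpose_apply, smul_eq_mul, Finset.sum_mul, Finset.mul_sum]
  refine Finset.sum_congr rfl fun a _ => Finset.sum_congr rfl fun b _ => ?_
  ring

/-- `formInner` does not depend on the frame: it is invariant under a simultaneous pull-back of the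
metric and of the forms by a real automorphism. -/
theorem formInner_comp {n k : ℕ} (B : Cn n →L[ℝ] Cn n →L[ℝ] ℝ) {A A' : Cn n →L[ℝ] Cn n}
    (hA : ∀ v, A' (A v) = v) (u v : AltForm n k) :
    formInner (B.bilinearComp A A) (u.compContinuousLinearMap A) (v.compContinuousLinearMap A)
      = formInner B u v := by
  have h1 : realMatrix n A' * realMatrix n A = 1 := by
    rw [← LinearMap.toMatrix_comp]
    convert! LinearMap.toMatrix_one (realBasis n).toBasis using 2
    ext1 v
    exact hA v
  have h2 := mul_eq_one_comm.1 h1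
  have h3 : (realMatrix n A)⁻¹ = realMatrix n A' := Matrix.inv_eq_left_inv h1
  rw [formInner_eq_contraction, formInner_eq_contraction, contraction_comp, gram_bilinearComp,
    Matrix.mul_inv_rev, Matrix.mul_inv_rev, ← Matrix.transpose_nonsing_inv, h3]
  congr 2
  calc _ = (realMatrix n A * realMatrix n A') * (gram B)⁻¹ *
        (realMatrix n A * realMatrix n A').transpose := by
        rw [Matrix.transpose_mul]; simp only [Matrix.mul_assoc]
    _ = _ := by rw [h2]; simp

theorem contraction_one {n k : ℕ} (u v : AltForm n k) :
    contraction 1 u v = ∑ I : Fin k → Fin (Module.finrank ℝ (Cn n)),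
      u (fun a => realBasis n (I a)) * conj (v (fun a => realBasis n (I a))) := by
  classical
  refine Finset.sum_congr rfl fun I _ => ?_
  rw [Finset.sum_eq_single I]
  · simp
  · intro J _ hJ
    obtain ⟨a, ha⟩ := Function.ne_iff.1 hJ
    rw [Finset.prod_eq_zero (Finset.mem_univ a), zero_mul, zero_mul]
    rw [Matrix.one_apply_ne (Ne.symm ha), Complex.ofReal_zero]
  · exact fun h => absurd (Finset.mem_univ _) h

theorem gram_posDef {n : ℕ} {B : Cn n →L[ℝ] Cn n →L[ℝ] ℝ} (hsymm : ∀ v w, B v w = B w v)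
    (hpos : ∀ v, v ≠ 0 → 0 < B v v) : (gram B).PosDef := by
  refine Matrix.PosDef.of_dotProduct_mulVec_pos ?_ fun x hx => ?_
  · ext i j
    simp [gram, hsymm]
  · set v : Cn n := ∑ i, x i • realBasis n i with hv
    have hv0 : v ≠ 0 := by
      intro h0
      refine hx (funext fun i => ?_)
      exact Fintype.linearIndependent_iff.1 (realBasis n).toBasis.linearIndependent x
        (by simpa using h0) i
    have h1 : B v v = star x ⬝ᵥ (gram B).mulVec x := by
      simp only [hv, map_sum, map_smul, sum_apply, smul_apply, dotProduct, Matrix.mulVec, gram,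
        Matrix.of_apply, smul_eq_mul, Pi.star_apply, star_trivial, Finset.mul_sum]
      rw [Finset.sum_comm]
      refine Finset.sum_congr rfl fun i _ => Finset.sum_congr rfl fun j _ => ?_
      ring
    rw [← h1]
    exact hpos v hv0

/-- In a frame which is orthonormal for `B`, the inner product `formInner B` is the standard one. -/
theorem exists_formInner_self_eq {n : ℕ} {B : Cn n →L[ℝ] Cn n →L[ℝ] ℝ}
    (hsymm : ∀ v w, B v w = B w v) (hpos : ∀ v, v ≠ 0 → 0 < B v v) :
    ∃ A A' : Cn n →L[ℝ] Cn n, (∀ v, A (A' v) = v) ∧ ∀ (k : ℕ) (u : AltForm n k),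
      formInner B u u = (((k.factorial : ℝ)⁻¹ * ∑ I : Fin k → Fin (Module.finrank ℝ (Cn n)),
        ‖u (fun a => A (realBasis n (I a)))‖ ^ 2 : ℝ) : ℂ) := by
  have hP := (gram_posDef hsymm hpos).inv
  obtain ⟨C, hC⟩ : ∃ C, (gram B)⁻¹ = star C * C := by
    open scoped MatrixOrder in
    exact CStarAlgebra.nonneg_iff_eq_star_mul_self.1 hP.posSemidef.nonneg
  have hCu : IsUnit C.det := by
    have h1 : IsUnit (star C * C).det := by
      rw [← hC]
      exact (Matrix.isUnit_iff_isUnit_det _).1 hP.isUnit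
    rw [Matrix.det_mul] at h1
    exact isUnit_of_mul_isUnit_right h1
  have hCt : C.transpose * C.transpose⁻¹ = 1 :=
    Matrix.mul_nonsing_inv _ (by rwa [Matrix.det_transpose])
  let L : Matrix (Fin (Module.finrank ℝ (Cn n))) (Fin (Module.finrank ℝ (Cn n))) ℝ →
      (Cn n →L[ℝ] Cn n) := fun M => LinearMap.toContinuousLinearMap
    (Matrix.toLin (realBasis n).toBasis (realBasis n).toBasis M)
  have hL : ∀ M, realMatrix n (L M) = M := fun M => by simp [L, realMatrix]
  refine ⟨L C.transpose, L C.transpose⁻¹, fun v => ?_, fun k u => ?_⟩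
  · have h2 := Matrix.toLin_mul_apply (realBasis n).toBasis (realBasis n).toBasis
      (realBasis n).toBasis C.transpose C.transpose⁻¹ v
    rw [hCt, Matrix.toLin_one] at h2
    exact h2.symm
  · have h3 : (gram B)⁻¹ = realMatrix n (L C.transpose) * 1 *
        (realMatrix n (L C.transpose)).transpose := by
      rw [hL, hC, Matrix.mul_one, Matrix.transpose_transpose]
      rfl
    rw [formInner_eq_contraction, h3, ← contraction_comp, contraction_one]
    push_cast
    congr 1
    refine Finset.sum_congr rfl fun I _ => ?_
    rw [Complex.mul_conj, Complex.normSq_eq_norm_sq]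
    push_cast
    rfl

theorem formInner_self_nonneg {n k : ℕ} {B : Cn n →L[ℝ] Cn n →L[ℝ] ℝ}
    (hsymm : ∀ v w, B v w = B w v) (hpos : ∀ v, v ≠ 0 → 0 < B v v) (u : AltForm n k) :
    0 ≤ (formInner B u u).re := by
  obtain ⟨A, A', -, hf⟩ := exists_formInner_self_eq hsymm hpos
  rw [hf, Complex.ofReal_re]
  positivity

theorem eq_zero_of_formInner_self {n k : ℕ} {B : Cn n →L[ℝ] Cn n →L[ℝ] ℝ}
    (hsymm : ∀ v w, B v w = B w v) (hpos : ∀ v, v ≠ 0 → 0 < B v v) {u : AltForm n k}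
    (hu : (formInner B u u).re = 0) : u = 0 := by
  obtain ⟨A, A', hA, hf⟩ := exists_formInner_self_eq hsymm hpos
  rw [hf, Complex.ofReal_re] at hu
  have h1 := (mul_eq_zero.1 hu).resolve_left (by positivity)
  rw [Finset.sum_eq_zero_iff_of_nonneg fun _ _ => by positivity] at h1
  have h2 : u.compContinuousLinearMap A = 0 := by
    refine ContinuousAlternatingMap.toAlternatingMap_injective ?_
    refine Module.Basis.ext_alternating (realBasis n).toBasis fun I _ => ?_
    have := h1 I (Finset.mem_univ I)
    simpa [Function.comp_def] using this
  ext v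
  have h3 := congrArg (fun w : AltForm n k => w (fun i => A' (v i))) h2
  simpa [Function.comp_def, hA] using h3

theorem formInner_add_right {n k : ℕ} (B : Cn n →L[ℝ] Cn n →L[ℝ] ℝ) (u v w : AltForm n k) :
    formInner B u (v + w) = formInner B u v + formInner B u w := by
  simp only [formInner, ContinuousAlternatingMap.add_apply, map_add, mul_add,
    Finset.sum_add_distrib]

theorem formInner_add_left {n k : ℕ} (B : Cn n →L[ℝ] Cn n →L[ℝ] ℝ) (u v w : AltForm n k) :
    formInner B (u + v) w = formInner B u w + formInner B v w := by
  simp only [formInner, ContinuousAlternatingMap.add_apply, add_mul, mul_add,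
    Finset.sum_add_distrib]

theorem formInner_smul_left {n k : ℕ} (B : Cn n →L[ℝ] Cn n →L[ℝ] ℝ) (a : ℂ) (u v : AltForm n k) :
    formInner B (a • u) v = a * formInner B u v := by
  simp only [formInner, ContinuousAlternatingMap.smul_apply, smul_eq_mul, Finset.mul_sum]
  refine Finset.sum_congr rfl fun I _ => Finset.sum_congr rfl fun J _ => ?_
  ring

theorem formInner_smul_right {n k : ℕ} (B : Cn n →L[ℝ] Cn n →L[ℝ] ℝ) (a : ℂ) (u v : AltForm n k) :
    formInner B u (a • v) = conj a * formInner B u v := by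
  simp only [formInner, ContinuousAlternatingMap.smul_apply, smul_eq_mul, map_mul, Finset.mul_sum]
  refine Finset.sum_congr rfl fun I _ => Finset.sum_congr rfl fun J _ => ?_
  ring

/-- `formInner B` as a sesquilinear form, conjugate linear in the second argument. -/
def formInnerSesq (n k : ℕ) (B : Cn n →L[ℝ] Cn n →L[ℝ] ℝ) :
    AltForm n k →ₗ[ℂ] AltForm n k →ₛₗ[starRingEnd ℂ] ℂ :=
  LinearMap.mk₂'ₛₗ (RingHom.id ℂ) (starRingEnd ℂ) (formInner B) (formInner_add_left B)
    (formInner_smul_left B) (formInner_add_right B) (formInner_smul_right B)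

theorem formInnerSesq_apply {n k : ℕ} (B : Cn n →L[ℝ] Cn n →L[ℝ] ℝ) (u v : AltForm n k) :
    formInnerSesq n k B u v = formInner B u v := rfl

/-- Since the multiplication by a unit complex number is an isometry of a Hermitian metric, the
rotations of forms are unitary. -/
theorem formInner_rot {n k : ℕ} {B : Cn n →L[ℝ] Cn n →L[ℝ] ℝ}
    (hI : ∀ v w, B (Complex.I • v) (Complex.I • w) = B v w) {ζ : ℂ} (hζ : conj ζ = ζ⁻¹)
    (hζ0 : ζ ≠ 0) (u v : AltForm n k) : formInner B (rot ζ u) (rot ζ v) = formInner B u v := by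
  have h1 : B.bilinearComp (ζ • ContinuousLinearMap.id ℝ (Cn n))
      (ζ • ContinuousLinearMap.id ℝ (Cn n)) = B := by
    have hsq : ζ.re * ζ.re + ζ.im * ζ.im = 1 := by
      have h2 : ((ζ.re * ζ.re + ζ.im * ζ.im : ℝ) : ℂ) = 1 := by
        rw [← Complex.normSq_apply, ← Complex.mul_conj, hζ, mul_inv_cancel₀ hζ0]
      exact_mod_cast h2
    have hexp : ∀ w : Cn n, ζ • w = ζ.re • w + ζ.im • (Complex.I • w) := fun w => by
      rw [← Complex.coe_smul, ← Complex.coe_smul, smul_smul, ← add_smul, Complex.re_add_im]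
    ext v w
    have h3 : B (Complex.I • v) w = - B v (Complex.I • w) := by
      have := hI v (Complex.I • w)
      rw [smul_smul, Complex.I_mul_I, neg_one_smul, map_neg] at this
      rw [← this, neg_neg]
    simp only [ContinuousLinearMap.bilinearComp_apply, smul_apply, ContinuousLinearMap.id_apply]
    rw [hexp v, hexp w]
    simp only [map_add, map_smul, add_apply, smul_apply, smul_eq_mul, h3, hI]
    linear_combination B v w * hsq
  conv_lhs => rw [← h1]
  exact formInner_comp B (A' := ζ⁻¹ • ContinuousLinearMap.id ℝ (Cn n))
    (fun v => by simp [smul_smul, hζ0]) u v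

/-- Components of different types are orthogonal for a Hermitian metric, because the rotations act
on them through different characters of the circle. -/
theorem formInner_typeProj_of_ne {n k p q : ℕ} {B : Cn n →L[ℝ] Cn n →L[ℝ] ℝ}
    (hI : ∀ v w, B (Complex.I • v) (Complex.I • w) = B v w) (hp : p ≤ k) (hq : q ≤ k)
    (hpq : p ≠ q) (u v : AltForm n k) : formInner B (typeProj p u) (typeProj q v) = 0 := by
  have hrot : ∀ (r : ℕ), r ≤ k → ∀ (ζ : ℂ) (w : AltForm n k),
      rot ζ (typeProj r w) = (ζ ^ r * conj ζ ^ (k - r)) • typeProj r w := fun r hr ζ w => by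
    ext x
    exact isOfType_typeProj hr w ζ x
  have h1 : ∀ j, (circlePt k j ^ q * conj (circlePt k j) ^ (k - q))⁻¹ *
      (circlePt k j ^ p * conj (circlePt k j) ^ (k - p)) *
        formInner B (typeProj p u) (typeProj q v) = formInner B (typeProj p u) (typeProj q v) := by
    intro j
    have h2 := formInner_rot hI (conj_circlePt k j) (circlePt_ne_zero k j) (typeProj p u)
      (typeProj q v)
    rw [hrot p hp, hrot q hq, formInner_smul_left, formInner_smul_right] at h2
    have h3 : conj (circlePt k j ^ q * conj (circlePt k j) ^ (k - q))
        = (circlePt k j ^ q * conj (circlePt k j) ^ (k - q))⁻¹ := by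
      rw [map_mul, map_pow, map_pow, Complex.conj_conj, conj_circlePt, mul_inv, inv_pow, inv_pow,
        inv_inv]
    rw [h3] at h2
    linear_combination h2
  have h4 : ∑ j ∈ Finset.range (k + 1), (circlePt k j ^ q * conj (circlePt k j) ^ (k - q))⁻¹ *
      (circlePt k j ^ p * conj (circlePt k j) ^ (k - p)) *
        formInner B (typeProj p u) (typeProj q v)
      = ((k : ℂ) + 1) * formInner B (typeProj p u) (typeProj q v) := by
    rw [Finset.sum_congr rfl fun j _ => h1 j]
    simp
  rw [← Finset.sum_mul, circlePt_sum hq hp, if_neg hpq.symm, zero_mul] at h4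
  have hk : ((k : ℂ) + 1) ≠ 0 := by exact_mod_cast Nat.succ_ne_zero k
  exact (mul_eq_zero.1 h4.symm).resolve_left hk

/-- The isometry property of the multiplication by `h ^ p` on forms of type `(p, q)`. -/
theorem formInnerRescaled_eq {n k : ℕ} {B : Cn n →L[ℝ] Cn n →L[ℝ] ℝ}
    (hI : ∀ v w, B (Complex.I • v) (Complex.I • w) = B v w) (h : ℝ) (u v : AltForm n k) :
    formInnerRescaled B h u v
      = formInner B (∑ p ∈ Finset.range (k + 1), ((h : ℂ) ^ p) • typeProj p u)
        (∑ p ∈ Finset.range (k + 1), ((h : ℂ) ^ p) • typeProj p v) := by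
  rw [← formInnerSesq_apply, map_sum (formInnerSesq n k B), LinearMap.sum_apply, formInnerRescaled]
  refine Finset.sum_congr rfl fun p hp => ?_
  rw [map_sum, Finset.sum_eq_single_of_mem p hp]
  · rw [formInnerSesq_apply, formInner_smul_left, formInner_smul_right, map_pow, Complex.conj_ofReal]
    ring
  · intro q hq hqp
    rw [formInnerSesq_apply, formInner_smul_left, formInner_smul_right,
      formInner_typeProj_of_ne hI (Nat.lt_succ_iff.1 (Finset.mem_range.1 hp))
        (Nat.lt_succ_iff.1 (Finset.mem_range.1 hq)) hqp.symm, mul_zero, mul_zero]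

/-! ### The exterior derivative and types of forms -/

/-- The exterior derivative of a form of type `(p, q)` has components of types `(p + 1, q)` and
`(p, q + 1)` only: the derivative contributes one more argument, in which it is the sum of a
`ℂ`-linear and of a conjugate linear map. -/
theorem typeProj_extDeriv {n k p r : ℕ} (hp : p ≤ k) (hr : r ≤ k + 1) (h0 : r ≠ p)
    (h1 : r ≠ p + 1) {f : Cn n → AltForm n k} {y : Cn n} (hf : DifferentiableAt ℝ f y)
    (hft : ∀ z, IsOfType p (k - p) (f z)) : typeProj r (extDeriv f y) = 0 := by
  ext v
  let D : Fin (k + 1) → Cn n →L[ℝ] ℂ := fun i => fderiv ℝ (fun x => f x (i.removeNth v)) y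
  let a : ℂ := ∑ i : Fin (k + 1),
    (-1 : ℂ) ^ (i : ℕ) * ((D i (v i) - Complex.I * D i (Complex.I • v i)) / 2)
  let b : ℂ := ∑ i : Fin (k + 1),
    (-1 : ℂ) ^ (i : ℕ) * ((D i (v i) + Complex.I * D i (Complex.I • v i)) / 2)
  refine (typeProj_apply hr _ v
    (fun s => if s = p + 1 then a else if s = p then b else 0) fun ζ => ?_).trans ?_
  · have hdiff : ∀ i : Fin (k + 1), DifferentiableAt ℝ (fun x => f x (i.removeNth v)) y := fun i =>
      (ContinuousAlternatingMap.apply ℝ (Cn n) ℂ (i.removeNth v)).differentiableAt.comp y hf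
    have hterm : ∀ i : Fin (k + 1),
        fderiv ℝ (fun x => f x (i.removeNth fun j => ζ • v j)) y (ζ • v i)
          = ζ ^ p * conj ζ ^ (k - p) * D i (ζ • v i) := by
      intro i
      have h2 : (fun x => f x (i.removeNth fun j => ζ • v j))
          = fun x => (ζ ^ p * conj ζ ^ (k - p)) * f x (i.removeNth v) :=
        funext fun x => hft x ζ (i.removeNth v)
      rw [h2, fderiv_const_mul (hdiff i)]
      rfl
    have hlin : ∀ i : Fin (k + 1), D i (ζ • v i)
        = ζ * ((D i (v i) - Complex.I * D i (Complex.I • v i)) / 2)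
          + conj ζ * ((D i (v i) + Complex.I * D i (Complex.I • v i)) / 2) := by
      intro i
      have h2 : ζ • v i = ζ.re • v i + ζ.im • (Complex.I • v i) := by
        rw [← Complex.coe_smul, ← Complex.coe_smul, smul_smul, ← add_smul, Complex.re_add_im]
      rw [h2, map_add, map_smul, map_smul, Complex.real_smul, Complex.real_smul,
        Complex.re_eq_add_conj, Complex.im_eq_sub_conj]
      field_simp
      linear_combination ((ζ - conj ζ) * D i (Complex.I • v i)) * Complex.I_sq
    rw [extDeriv_apply hf]
    simp_rw [hterm, hlin]
    have hsum : ∀ s ∈ Finset.range (k + 1 + 1),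
        ζ ^ s * conj ζ ^ (k + 1 - s) * (if s = p + 1 then a else if s = p then b else 0)
          = (if s = p + 1 then ζ ^ (p + 1) * conj ζ ^ (k - p) * a else 0)
            + (if s = p then ζ ^ p * conj ζ ^ (k - p + 1) * b else 0) := by
      intro s _
      by_cases hs : s = p + 1
      · subst hs
        rw [if_pos rfl, if_pos rfl, if_neg (by omega), Nat.add_sub_add_right, add_zero]
      · by_cases hs' : s = p
        · subst hs'
          rw [if_neg hs, if_pos rfl, if_neg hs, if_pos rfl, zero_add, Nat.sub_add_comm hp]
        · simp [hs, hs']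
    rw [Finset.sum_congr rfl hsum, Finset.sum_add_distrib, Finset.sum_ite_eq', Finset.sum_ite_eq',
      if_pos (Finset.mem_range.2 (by omega)), if_pos (Finset.mem_range.2 (by omega)),
      Finset.mul_sum, Finset.mul_sum, ← Finset.sum_add_distrib]
    refine Finset.sum_congr rfl fun i _ => ?_
    rw [zsmul_eq_mul]
    push_cast
    ring
  · simp [h0, h1]

section

variable {n : ℕ} {X : Type*} [TopologicalSpace X] [ChartedSpace (Cn n) X]
  [IsManifold 𝓘(ℂ, Cn n) ω X]

theorem differentiableAt_localRep {k : ℕ} (u : Form n X k) (x : X) :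
    DifferentiableAt ℝ (localRep u.1 x) (chartAt (Cn n) x x) :=
  ((u.2 x).contDiffAt ((chartAt (Cn n) x).open_target.mem_nhds
    (mem_chart_target _ x))).differentiableAt (by simp)

theorem component_d_component {k p r : ℕ} (hp : p ≤ k) (hr : r ≤ k + 1) (h0 : r ≠ p)
    (h1 : r ≠ p + 1) (u : Form n X k) : component r (d k (component p u)) = 0 := by
  refine Subtype.ext (funext fun x => ?_)
  refine typeProj_extDeriv hp hr h0 h1 (differentiableAt_localRep (component p u) x) fun z => ?_
  have h2 : localRep (component p u).1 x z = typeProj p (localRep u.1 x z) :=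
    (typeProj_comp p _ _).symm
  rw [h2]
  exact isOfType_typeProj hp _

theorem sum_component {k : ℕ} (u : Form n X k) :
    ∑ p ∈ Finset.range (k + 1), component p u = u := by
  refine Subtype.ext (funext fun x => ?_)
  rw [AddSubmonoidClass.coe_finsetSum, Finset.sum_apply]
  exact sum_typeProj (u.1 x)

theorem component_component {k p q : ℕ} (hp : p ≤ k) (hq : q ≤ k) (u : Form n X k) :
    component p (component q u) = if p = q then component q u else 0 := by
  refine Subtype.ext (funext fun x => (typeProj_typeProj hp hq (u.1 x)).trans ?_)
  split_ifs <;> rfl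

theorem component_thetaMap (h : ℝ) {k p : ℕ} (hp : p ≤ k) (u : Form n X k) :
    component p (thetaMap h k u) = ((h : ℂ) ^ p) • component p u := by
  rw [thetaMap, LinearMap.sum_apply, map_sum,
    Finset.sum_eq_single_of_mem p (Finset.mem_range.2 (Nat.lt_succ_of_le hp))]
  · rw [LinearMap.smul_apply, map_smul, component_component hp hp, if_pos rfl]
  · intro q hq hqp
    rw [LinearMap.smul_apply, map_smul,
      component_component hp (Nat.lt_succ_iff.1 (Finset.mem_range.1 hq)), if_neg hqp.symm,
      smul_zero]

/-- `θ_h d = d_h θ_h`: on a form `u` of type `(p, q)` both sides are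
`h ^ (p + 1) ∂u + h ^ p ∂̄u`. -/
theorem thetaMap_d (h : ℝ) (k : ℕ) (u : Form n X k) :
    thetaMap h (k + 1) (d k u) = dh h k (thetaMap h k u) := by
  have h1 : ∀ p ∈ Finset.range (k + 1), thetaMap h (k + 1) (d k (component p u))
      = ((h : ℂ) ^ (p + 1)) • component (p + 1) (d k (component p u))
        + ((h : ℂ) ^ p) • component p (d k (component p u)) := by
    intro p hp
    have hpk := Nat.lt_succ_iff.1 (Finset.mem_range.1 hp)
    rw [thetaMap, LinearMap.sum_apply,
      ← Finset.sum_subset (s₁ := {p + 1, p}) (by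
        intro r hr
        simp only [Finset.mem_insert, Finset.mem_singleton] at hr
        exact Finset.mem_range.2 (by omega)),
      Finset.sum_pair (by omega)]
    · rfl
    · intro r hr hr'
      simp only [Finset.mem_insert, Finset.mem_singleton, not_or] at hr'
      rw [LinearMap.smul_apply, component_d_component hpk
        (Nat.lt_succ_iff.1 (Finset.mem_range.1 hr)) hr'.2 hr'.1, smul_zero]
  conv_lhs => rw [← sum_component u, map_sum, map_sum, Finset.sum_congr rfl h1]
  rw [dh, LinearMap.add_apply, LinearMap.smul_apply, del, delbar, LinearMap.sum_apply,
    LinearMap.sum_apply, Finset.smul_sum, ← Finset.sum_add_distrib]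
  refine Finset.sum_congr rfl fun p hp => ?_
  rw [LinearMap.comp_apply, LinearMap.comp_apply, LinearMap.comp_apply, LinearMap.comp_apply,
    component_thetaMap h (Nat.lt_succ_iff.1 (Finset.mem_range.1 hp))]
  simp only [map_smul, smul_smul, pow_succ']

end

open MeasureTheory Set

/-! ### Coordinate expressions of the metric -/

section

variable {n : ℕ} {X : Type*} [TopologicalSpace X] [ChartedSpace (Cn n) X]
  [IsManifold 𝓘(ℂ, Cn n) ω X]

theorem HermitianMetric.bilin_symm (g : HermitianMetric n X) (x : X) (v w : Cn n) :
    g.bilin x v w = g.bilin x w v := g.symm x v w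

theorem HermitianMetric.bilin_pos (g : HermitianMetric n X) (x : X) (v : Cn n) (hv : v ≠ 0) :
    0 < g.bilin x v v := g.pos x v hv

theorem HermitianMetric.bilin_I_smul (g : HermitianMetric n X) (x : X) (v w : Cn n) :
    g.bilin x (Complex.I • v) (Complex.I • w) = g.bilin x v w := g.inner_I_smul x v w

theorem tangentCoordChange_leftInverse {c x : X} (hx : x ∈ (chartAt (Cn n) c).source) (v : Cn n) :
    tangentCoordChange 𝓘(ℂ, Cn n) x c x (tangentCoordChange 𝓘(ℂ, Cn n) c x x v) = v := by
  have h1 : x ∈ (extChartAt 𝓘(ℂ, Cn n) c).source := by rwa [extChartAt_source]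
  rw [tangentCoordChange_comp ⟨⟨h1, mem_extChartAt_source x⟩, h1⟩, tangentCoordChange_self h1]

/-- The real and the complex tangent bundles have the same coordinate changes. -/
theorem tangentCoordChange_real {c x : X} (hx : x ∈ (chartAt (Cn n) c).source) (v : Cn n) :
    tangentCoordChange 𝓘(ℝ, Cn n) c x x v = tangentCoordChange 𝓘(ℂ, Cn n) c x x v := by
  have h1 := hasFDerivWithinAt_tangentCoordChange (I := 𝓘(ℂ, Cn n)) (x := c) (y := x) (z := x)
    ⟨by rwa [extChartAt_source], mem_extChartAt_source x⟩
  have h2 := hasFDerivWithinAt_tangentCoordChange (I := 𝓘(ℝ, Cn n)) (x := c) (y := x) (z := x)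
    ⟨by rwa [extChartAt_source], mem_extChartAt_source x⟩
  rw [modelWithCornersSelf_coe, range_id, hasFDerivWithinAt_univ] at h1 h2
  exact congrArg (fun L : Cn n →L[ℝ] Cn n => L v) (h2.unique (h1.restrictScalars ℝ))

theorem formInner_eq_local {k : ℕ} (b : BilinField n X) (u v : X → AltForm n k) (c : X) {y : Cn n}
    (hy : y ∈ (chartAt (Cn n) c).target) :
    formInner (b ((chartAt (Cn n) c).symm y)) (u ((chartAt (Cn n) c).symm y))
        (v ((chartAt (Cn n) c).symm y))
      = formInner (localBilin b c y) (localRep u c y) (localRep v c y) := by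
  have hx := (chartAt (Cn n) c).map_target hy
  set x := (chartAt (Cn n) c).symm y
  exact (formInner_comp (b x)
    (A := (tangentCoordChange 𝓘(ℂ, Cn n) c x x).restrictScalars ℝ)
    (A' := (tangentCoordChange 𝓘(ℂ, Cn n) x c x).restrictScalars ℝ)
    (tangentCoordChange_leftInverse hx) (u x) (v x)).symm

theorem gram_localBilin_posDef (g : HermitianMetric n X) (c : X) {y : Cn n}
    (hy : y ∈ (chartAt (Cn n) c).target) : (gram (localBilin g.bilin c y)).PosDef := by
  have hx := (chartAt (Cn n) c).map_target hy
  refine gram_posDef (fun v w => g.bilin_symm _ _ _) fun v hv => g.bilin_pos _ _ fun h0 => hv ?_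
  set x := (chartAt (Cn n) c).symm y
  have h1 : tangentCoordChange 𝓘(ℂ, Cn n) c x x v = 0 := h0
  rw [← tangentCoordChange_leftInverse hx v, h1, map_zero]

theorem continuousOn_localBilin (g : HermitianMetric n X) (c : X) (v w : Cn n) :
    ContinuousOn (fun y => localBilin g.bilin c y v w) (chartAt (Cn n) c).target := by
  let e := trivializationAt (Cn n) (TangentSpace 𝓘(ℝ, Cn n) : X → Type _) c
  have hsec : ∀ v : Cn n, ContinuousOn
      (fun x => Bundle.TotalSpace.mk' (Cn n) x (e.symm x v)) (chartAt (Cn n) c).source := by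
    intro v
    exact e.continuousOn_symm.comp (Continuous.prodMk_left v).continuousOn
      fun x hx => ⟨hx, mem_univ _⟩
  have h1 := ContinuousOn.clm_bundle_apply₂ (F₁ := Cn n) (F₂ := Cn n) (F₃ := ℝ)
    (E₁ := (TangentSpace 𝓘(ℝ, Cn n) : X → Type _)) (E₂ := (TangentSpace 𝓘(ℝ, Cn n) : X → Type _))
    (E₃ := Bundle.Trivial X ℝ) (b := fun x => x)
    (ψ := fun x => g.inner x)
    (g.contMDiff.continuous.continuousOn (s := (chartAt (Cn n) c).source)) (hsec v) (hsec w)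
  have h2 : ContinuousOn (fun x => g.inner x (e.symm x v) (e.symm x w))
      (chartAt (Cn n) c).source := fun x hx =>
    ((Bundle.Trivial.homeomorphProd X ℝ).continuous.snd.continuousAt.comp_continuousWithinAt
      (h1 x hx))
  refine (h2.comp (chartAt (Cn n) c).continuousOn_symm
    (chartAt (Cn n) c).mapsTo_symm).congr fun y hy => ?_
  have hx := (chartAt (Cn n) c).map_target hy
  have h3 : ∀ v : Cn n, e.symm ((chartAt (Cn n) c).symm y) v = tangentCoordChange 𝓘(ℂ, Cn n) c
      ((chartAt (Cn n) c).symm y) ((chartAt (Cn n) c).symm y) v := by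
    intro v
    rw [← tangentCoordChange_real hx]
    have := TangentBundle.symmL_trivializationAt_eq_core (I := 𝓘(ℝ, Cn n)) (b₀ := c) hx
    exact (e.symmL_apply (R := ℝ) hx v).symm.trans
      (congrArg (fun L : Cn n →L[ℝ] Cn n => L v) this)
  simp only [Function.comp_apply, h3]
  rfl

theorem continuousOn_gram_localBilin (g : HermitianMetric n X) (c : X) :
    ContinuousOn (fun y => gram (localBilin g.bilin c y)) (chartAt (Cn n) c).target :=
  continuousOn_pi.2 fun _ => continuousOn_pi.2 fun _ => continuousOn_localBilin g c _ _

theorem continuousOn_volDensity (g : HermitianMetric n X) (c : X) :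
    ContinuousOn (volDensity g.bilin c) (chartAt (Cn n) c).target :=
  Real.continuous_sqrt.comp_continuousOn
    (Continuous.matrix_det continuous_id |>.comp_continuousOn (continuousOn_gram_localBilin g c))

theorem volDensity_pos (g : HermitianMetric n X) (c : X) {y : Cn n}
    (hy : y ∈ (chartAt (Cn n) c).target) : 0 < volDensity g.bilin c y :=
  Real.sqrt_pos.2 (gram_localBilin_posDef g c hy).det_pos

theorem continuousOn_formInner (g : HermitianMetric n X) {k : ℕ} (u v : Form n X k) (c : X) :
    ContinuousOn (fun y => formInner (g.bilin ((chartAt (Cn n) c).symm y))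
      (u.1 ((chartAt (Cn n) c).symm y)) (v.1 ((chartAt (Cn n) c).symm y)))
      (chartAt (Cn n) c).target := by
  refine ContinuousOn.congr ?_ fun y hy => formInner_eq_local g.bilin u.1 v.1 c hy
  have hG := continuousOn_gram_localBilin g c
  have hinv : ∀ i j, ContinuousOn (fun y => (gram (localBilin g.bilin c y))⁻¹ i j)
      (chartAt (Cn n) c).target := by
    intro i j
    have h1 : ContinuousOn (fun y => ((gram (localBilin g.bilin c y)).det)⁻¹ *
        (gram (localBilin g.bilin c y)).adjugate i j) (chartAt (Cn n) c).target :=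
      ((Continuous.matrix_det continuous_id |>.comp_continuousOn hG).inv₀ fun y hy =>
        (gram_localBilin_posDef g c hy).det_pos.ne').mul
        ((Continuous.matrix_elem (Continuous.matrix_adjugate continuous_id) i j).comp_continuousOn
          hG)
    refine h1.congr fun y hy => ?_
    rw [Matrix.inv_def, Ring.inverse_eq_inv', Matrix.smul_apply, smul_eq_mul]
  have happ : ∀ (w : Form n X k) (z : Fin k → Cn n),
      ContinuousOn (fun y => localRep w.1 c y z) (chartAt (Cn n) c).target := fun w z =>
    (ContinuousAlternatingMap.apply ℝ (Cn n) ℂ z).continuous.comp_continuousOn (w.2 c).continuousOn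
  unfold formInner
  refine continuousOn_const.mul (continuousOn_finsetSum _ fun I _ =>
    continuousOn_finsetSum _ fun J _ => ContinuousOn.mul (ContinuousOn.mul ?_ (happ u _)) ?_)
  · exact continuousOn_finsetProd _ fun a _ =>
      Complex.continuous_ofReal.comp_continuousOn (hinv (I a) (J a))
  · exact Complex.continuous_conj.comp_continuousOn (happ v _)

/-! ### The `L²` inner product is additive and positive definite -/

variable [T2Space X] [CompactSpace X]

/-- The integrand of the `L²` inner product in the chart at `c`. -/
def innerDensity (g : HermitianMetric n X) {k : ℕ} (u v : Form n X k) (c : X) (y : Cn n) : ℂ :=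
  ((partition n X c ((chartAt (Cn n) c).symm y) * volDensity g.bilin c y : ℝ) : ℂ) *
    formInner (g.bilin ((chartAt (Cn n) c).symm y)) (u.1 ((chartAt (Cn n) c).symm y))
      (v.1 ((chartAt (Cn n) c).symm y))

theorem innerL2_eq_finsum (g : HermitianMetric n X) {k : ℕ} (u v : Form n X k) :
    innerL2 g u v = ∑ᶠ c : X, ∫ y in (chartAt (Cn n) c).target, innerDensity g u v c y := rfl

theorem continuousOn_innerDensity (g : HermitianMetric n X) {k : ℕ} (u v : Form n X k) (c : X) :
    ContinuousOn (innerDensity g u v c) (chartAt (Cn n) c).target :=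
  (Complex.continuous_ofReal.comp_continuousOn
    (((partition n X c).contMDiff.continuous.comp_continuousOn (chartAt (Cn n) c).continuousOn_symm).mul
      (continuousOn_volDensity g c))).mul (continuousOn_formInner g u v c)

theorem tsupport_partition_subset (c : X) :
    tsupport (partition n X c) ⊆ (chartAt (Cn n) c).source :=
  Classical.choose_spec
    (SmoothPartitionOfUnity.exists_isSubordinate_chartAt_source 𝓘(ℝ, Cn n) X) c

theorem integrableOn_innerDensity (g : HermitianMetric n X) {k : ℕ} (u v : Form n X k) (c : X) :
    IntegrableOn (innerDensity g u v c) (chartAt (Cn n) c).target := by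
  -- the support of the integrand is contained in the image of the support of the cut-off function
  have hK : IsCompact (chartAt (Cn n) c '' tsupport (partition n X c)) :=
    (isClosed_tsupport _).isCompact.image_of_continuousOn
      ((chartAt (Cn n) c).continuousOn.mono (tsupport_partition_subset c))
  have hKt : chartAt (Cn n) c '' tsupport (partition n X c) ⊆ (chartAt (Cn n) c).target :=
    ((chartAt (Cn n) c).mapsTo.mono_left (tsupport_partition_subset c)).image_subset
  refine IntegrableOn.of_forall_sdiff_eq_zero
    (((continuousOn_innerDensity g u v c).mono hKt).integrableOn_compact hK)
    (chartAt (Cn n) c).open_target.measurableSet fun y hy => ?_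
  have h0 : partition n X c ((chartAt (Cn n) c).symm y) = 0 := by
    by_contra hne
    exact hy.2 ⟨_, subset_tsupport _ hne, (chartAt (Cn n) c).right_inv hy.1⟩
  rw [innerDensity, h0, zero_mul, Complex.ofReal_zero, zero_mul]

theorem finite_support_partition :
    {c : X | (Function.support (partition n X c)).Nonempty}.Finite :=
  (partition n X).locallyFinite.finite_nonempty_of_compact

theorem support_integral_innerDensity (g : HermitianMetric n X) {k : ℕ} (u v : Form n X k) :
    (Function.support fun c : X => ∫ y in (chartAt (Cn n) c).target, innerDensity g u v c y)
      ⊆ {c : X | (Function.support (partition n X c)).Nonempty} := by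
  intro c hc
  by_contra hne
  refine hc ?_
  have h0 : ∀ x, partition n X c x = 0 := fun x => by
    by_contra h
    exact hne ⟨x, h⟩
  simp [innerDensity, h0]

theorem innerL2_add_right (g : HermitianMetric n X) {k : ℕ} (u v w : Form n X k) :
    innerL2 g u (v + w) = innerL2 g u v + innerL2 g u w := by
  rw [innerL2_eq_finsum, innerL2_eq_finsum, innerL2_eq_finsum, ← finsum_add_distrib
    (finite_support_partition.subset (support_integral_innerDensity g u v))
    (finite_support_partition.subset (support_integral_innerDensity g u w))]
  refine finsum_congr fun c => ?_
  rw [← integral_add (integrableOn_innerDensity g u v c) (integrableOn_innerDensity g u w c)]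
  refine integral_congr_ae (Filter.Eventually.of_forall fun y => ?_)
  simp only [innerDensity]
  rw [← mul_add, ← formInner_add_right]
  rfl

theorem innerDensity_self_re_nonneg (g : HermitianMetric n X) {k : ℕ} (u : Form n X k) (c : X)
    (y : Cn n) : 0 ≤ (innerDensity g u u c y).re := by
  rw [innerDensity, Complex.re_ofReal_mul]
  exact mul_nonneg (mul_nonneg ((partition n X).nonneg c _) (Real.sqrt_nonneg _))
    (formInner_self_nonneg (g.bilin_symm _) (g.bilin_pos _) _)

theorem eq_zero_of_innerL2_self (g : HermitianMetric n X) {k : ℕ} {u : Form n X k}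
    (hu : innerL2 g u u = 0) : u = 0 := by
  have hre : ∀ c : X, (∫ y in (chartAt (Cn n) c).target, innerDensity g u u c y).re
      = ∫ y in (chartAt (Cn n) c).target, (innerDensity g u u c y).re := fun c =>
    (integral_re (𝕜 := ℂ) (integrableOn_innerDensity g u u c)).symm
  have hnn : ∀ c : X, 0 ≤ ∫ y in (chartAt (Cn n) c).target, (innerDensity g u u c y).re :=
    fun c => integral_nonneg fun y => innerDensity_self_re_nonneg g u c y
  have hsum := congrArg Complex.re hu
  rw [innerL2_eq_finsum, finsum_eq_sum_of_support_subset (s := finite_support_partition.toFinset) _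
    (by simpa using support_integral_innerDensity g u u), Complex.re_sum, Complex.zero_re,
    Finset.sum_congr rfl fun c _ => hre c,
    Finset.sum_eq_zero_iff_of_nonneg fun c _ => hnn c] at hsum
  refine Subtype.ext (funext fun x => ?_)
  -- at `x` one of the functions of the partition of unity is positive
  obtain ⟨c, hc⟩ : ∃ c, 0 < partition n X c x := (partition n X).exists_pos_of_mem (mem_univ x)
  have hxc : x ∈ (chartAt (Cn n) c).source :=
    tsupport_partition_subset c (subset_tsupport _ hc.ne')
  have hzero := hsum c (finite_support_partition.mem_toFinset.2 ⟨x, hc.ne'⟩)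
  rw [setIntegral_eq_zero_iff_of_nonneg_ae
    (Filter.Eventually.of_forall fun y => innerDensity_self_re_nonneg g u c y)
    (integrableOn_innerDensity g u u c).re] at hzero
  have heq := Measure.eqOn_open_of_ae_eq hzero (chartAt (Cn n) c).open_target
    (Complex.continuous_re.comp_continuousOn (continuousOn_innerDensity g u u c))
    continuousOn_const
  have hy := (chartAt (Cn n) c).map_source hxc
  have h1 : (innerDensity g u u c (chartAt (Cn n) c x)).re = 0 := heq hy
  rw [innerDensity, Complex.re_ofReal_mul, (chartAt (Cn n) c).left_inv hxc] at h1
  exact eq_zero_of_formInner_self (g.bilin_symm x) (g.bilin_pos x)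
    ((mul_eq_zero.1 h1).resolve_left (mul_pos hc (volDensity_pos g c hy)).ne')

theorem eq_of_innerL2_right (g : HermitianMetric n X) {k : ℕ} {v w : Form n X k}
    (h : ∀ u, innerL2 g u v = innerL2 g u w) : v = w := by
  refine sub_eq_zero.1 (eq_zero_of_innerL2_self g ?_)
  have h1 := innerL2_add_right g (v - w) (v - w) w
  rw [sub_add_cancel, h] at h1
  exact left_eq_add.1 (h1.trans (add_comm _ _))

end

/-! ### The rescaled `L²` inner product -/

section

variable {n : ℕ} {X : Type*} [TopologicalSpace X] [ChartedSpace (Cn n) X]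
  [IsManifold 𝓘(ℂ, Cn n) ω X]

theorem theta_apply {h : ℝ} (hh : 0 < h) {k : ℕ} (u : Form n X k) :
    theta hh k u = thetaMap h k u := rfl

theorem formInnerRescaled_theta (g : HermitianMetric n X) {h : ℝ} (hh : 0 < h) {k : ℕ}
    (u v : Form n X k) (x : X) :
    formInnerRescaled (g.bilin x) h (u.1 x) (v.1 x)
      = formInner (g.bilin x) ((theta hh k u).1 x) ((theta hh k v).1 x) := by
  have h1 : ∀ w : Form n X k, (theta hh k w).1 x
      = ∑ p ∈ Finset.range (k + 1), ((h : ℂ) ^ p) • typeProj p (w.1 x) := fun w => by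
    rw [theta_apply, thetaMap, LinearMap.sum_apply, AddSubmonoidClass.coe_finsetSum,
      Finset.sum_apply]
    rfl
  rw [formInnerRescaled_eq (g.bilin_I_smul x), h1, h1]

theorem volDensity_smul (b : BilinField n X) {h : ℝ} (hh : 0 < h) (c : X) (y : Cn n) :
    volDensity (fun x => (h ^ 2)⁻¹ • b x) c y
      = (h ^ Module.finrank ℝ (Cn n))⁻¹ * volDensity b c y := by
  have h1 : gram (localBilin (fun x => (h ^ 2)⁻¹ • b x) c y)
      = (h ^ 2)⁻¹ • gram (localBilin b c y) := rfl
  have h2 : ((h ^ 2)⁻¹) ^ Module.finrank ℝ (Cn n) = ((h ^ Module.finrank ℝ (Cn n))⁻¹) ^ 2 := by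
    rw [inv_pow, inv_pow, ← pow_mul, ← pow_mul, mul_comm]
  rw [volDensity, volDensity, h1, Matrix.det_smul, Fintype.card_fin, h2,
    Real.sqrt_mul (sq_nonneg _), Real.sqrt_sq (by positivity)]

/-- Up to a constant factor, the change of the volume element, `θ_h` is an isometry for the `L²`
inner products. -/
theorem innerL2Rescaled_eq [T2Space X] [CompactSpace X] (g : HermitianMetric n X) {h : ℝ}
    (hh : 0 < h) {k : ℕ} (u v : Form n X k) :
    innerL2Rescaled g h u v = (((h ^ Module.finrank ℝ (Cn n))⁻¹ : ℝ) : ℂ) *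
      innerL2 g (theta hh k u) (theta hh k v) := by
  rw [innerL2Rescaled, innerL2, integral, integral, mul_finsum]
  refine finsum_congr fun c => ?_
  rw [← integral_const_mul]
  refine integral_congr_ae (Filter.Eventually.of_forall fun y => ?_)
  simp only [volDensity_smul g.bilin hh, formInnerRescaled_theta g hh]
  push_cast
  ring

end

/-! ### Transport of formal adjoints -/

section

variable {V W V' W' : Type*} [AddCommGroup V] [Module ℂ V] [AddCommGroup W] [Module ℂ W]
  [AddCommGroup V'] [Module ℂ V'] [AddCommGroup W'] [Module ℂ W']

theorem IsFormalAdjoint.eq {ipV : V → V → ℂ} {ipW : W → W → ℂ}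
    (hV : ∀ {v w : V}, (∀ u, ipV u v = ipV u w) → v = w) {D : V →ₗ[ℂ] W} {S S' : W →ₗ[ℂ] V}
    (hS : IsFormalAdjoint ipV ipW D S) (hS' : IsFormalAdjoint ipV ipW D S') : S = S' :=
  LinearMap.ext fun v => hV fun u => (hS u v).symm.trans (hS' u v)

theorem IsFormalAdjoint.formalAdjoint_eq {ipV : V → V → ℂ} {ipW : W → W → ℂ}
    (hV : ∀ {v w : V}, (∀ u, ipV u v = ipV u w) → v = w) {D : V →ₗ[ℂ] W} {S : W →ₗ[ℂ] V}
    (hS : IsFormalAdjoint ipV ipW D S) : formalAdjoint ipV ipW D = S := by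
  have H : ∃ S, IsFormalAdjoint ipV ipW D S := ⟨S, hS⟩
  rw [formalAdjoint, dif_pos H]
  exact (Classical.choose_spec H).eq hV hS

/-- Formal adjoints correspond to each other under isometries up to a common constant `a` which
intertwine the operators. -/
theorem isFormalAdjoint_iff {ipV : V → V → ℂ} {ipW : W → W → ℂ} {ipV' : V' → V' → ℂ}
    {ipW' : W' → W' → ℂ} {a : ℂ} (ha : a ≠ 0) (eV : V' ≃ₗ[ℂ] V) (eW : W' ≃ₗ[ℂ] W)
    (hV' : ∀ u v, ipV' u v = a * ipV (eV u) (eV v))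
    (hW' : ∀ u v, ipW' u v = a * ipW (eW u) (eW v)) {D : V →ₗ[ℂ] W} {D' : V' →ₗ[ℂ] W'}
    (hD : ∀ u, eW (D' u) = D (eV u)) (S' : W' →ₗ[ℂ] V') :
    IsFormalAdjoint ipV' ipW' D' S' ↔
      IsFormalAdjoint ipV ipW D (eV.toLinearMap ∘ₗ S' ∘ₗ eW.symm.toLinearMap) := by
  constructor
  · intro hS u v
    have h1 := hS (eV.symm u) (eW.symm v)
    rw [hV', hW', hD, LinearEquiv.apply_symm_apply, LinearEquiv.apply_symm_apply] at h1
    exact mul_left_cancel₀ ha h1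
  · intro hS u v
    have h1 := hS (eV u) (eW v)
    rw [hV', hW', hD, h1]
    simp

/-- The formal adjoint is natural under such isometries. Either both operators have a formal adjoint,
and it is unique because the inner products are nondegenerate, or none of them has one. -/
theorem map_formalAdjoint {ipV : V → V → ℂ} {ipW : W → W → ℂ} {ipV' : V' → V' → ℂ}
    {ipW' : W' → W' → ℂ} {a : ℂ} (ha : a ≠ 0) (eV : V' ≃ₗ[ℂ] V) (eW : W' ≃ₗ[ℂ] W)
    (hV : ∀ {v w : V}, (∀ u, ipV u v = ipV u w) → v = w)
    (hV' : ∀ u v, ipV' u v = a * ipV (eV u) (eV v))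
    (hW' : ∀ u v, ipW' u v = a * ipW (eW u) (eW v)) {D : V →ₗ[ℂ] W} {D' : V' →ₗ[ℂ] W'}
    (hD : ∀ u, eW (D' u) = D (eV u)) (w : W') :
    eV (formalAdjoint ipV' ipW' D' w) = formalAdjoint ipV ipW D (eW w) := by
  by_cases H : ∃ S', IsFormalAdjoint ipV' ipW' D' S'
  · rw [((isFormalAdjoint_iff ha eV eW hV' hW' hD _).1
      (Classical.choose_spec H)).formalAdjoint_eq hV, formalAdjoint, dif_pos H]
    simp
  · have H' : ¬ ∃ S, IsFormalAdjoint ipV ipW D S := by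
      rintro ⟨S, hS⟩
      refine H ⟨eV.symm.toLinearMap ∘ₗ S ∘ₗ eW.toLinearMap,
        (isFormalAdjoint_iff ha eV eW hV' hW' hD _).2 ?_⟩
      convert! hS using 1
      ext v
      simp
    rw [formalAdjoint, formalAdjoint, dif_neg H, dif_neg H']
    simp

end

/-! ### Conjugation of the Laplacians -/

section

variable {n : ℕ} {X : Type*} [TopologicalSpace X] [ChartedSpace (Cn n) X]
  [IsManifold 𝓘(ℂ, Cn n) ω X]

theorem theta_d {h : ℝ} (hh : 0 < h) (k : ℕ) (u : Form n X k) :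
    theta hh (k + 1) (d k u) = dh h k (theta hh k u) := thetaMap_d h k u

theorem theta_hodgeLaplacian {h : ℝ} (hh : 0 < h) {D D' : ∀ k, Form n X k →ₗ[ℂ] Form n X (k + 1)}
    {S S' : ∀ k, Form n X (k + 1) →ₗ[ℂ] Form n X k}
    (hD : ∀ k u, theta hh (k + 1) (D' k u) = D k (theta hh k u))
    (hS : ∀ k u, theta hh k (S' k u) = S k (theta hh (k + 1) u)) (k : ℕ) (u : Form n X k) :
    theta hh k (hodgeLaplacian D' S' k u) = hodgeLaplacian D S k (theta hh k u) := by
  cases k with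
  | zero => simp only [hodgeLaplacian, LinearMap.comp_apply, hS, hD]
  | succ k => simp only [hodgeLaplacian, LinearMap.add_apply, LinearMap.comp_apply, map_add, hS, hD]

theorem theta_laplacianMetric [T2Space X] [CompactSpace X] (g : HermitianMetric n X) {h : ℝ}
    (hh : 0 < h) (k : ℕ) (u : Form n X k) :
    theta hh k (laplacianMetric g h k u) = laplacianH g h k (theta hh k u) :=
  theta_hodgeLaplacian hh (theta_d hh) (fun k w =>
    map_formalAdjoint (Complex.ofReal_ne_zero.2 (inv_ne_zero (pow_ne_zero _ hh.ne')))
      (theta hh k) (theta hh (k + 1)) (eq_of_innerL2_right g) (innerL2Rescaled_eq g hh)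
      (innerL2Rescaled_eq g hh) (theta_d hh k) w) k u

end

theorem map_eigenspace_conj {V : Type*} [AddCommGroup V] [Module ℂ V] (e : V ≃ₗ[ℂ] V)
    (T : Module.End ℂ V) (lam : ℂ) :
    (T.eigenspace lam).map e.toLinearMap = (e.conj T).eigenspace lam := by
  ext v
  rw [Submodule.mem_map_equiv, Module.End.mem_eigenspace_iff, Module.End.mem_eigenspace_iff,
    LinearEquiv.conj_apply_apply, ← map_smul, LinearEquiv.eq_symm_apply]

end

end RescaledLaplacian

open RescaledLaplacian
theorem corollary2p8 (n : ℕ) (X : Type*) [TopologicalSpace X] [T2Space X] [CompactSpace X]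
    [ChartedSpace (Cn n) X] [IsManifold 𝓘(ℂ, Cn n) ω X] (g : HermitianMetric n X)
    (h : ℝ) (hh : 0 < h) (k : ℕ) :
    (∀ (u v : Form n X k) (x : X),
      formInnerRescaled (g.bilin x) h (u.1 x) (v.1 x)
        = formInner (g.bilin x) ((theta hh k u).1 x) ((theta hh k v).1 x)) ∧
    laplacianH g h k = (theta hh k).conj (laplacianMetric g h k) ∧
    spectrum ℂ (laplacianH g h k) = spectrum ℂ (laplacianMetric g h k) ∧
    (∀ lam : ℂ, (laplacianH g h k).HasEigenvalue lam ↔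
      (laplacianMetric g h k).HasEigenvalue lam) ∧
    (∀ lam : ℂ, ((laplacianMetric g h k).eigenspace lam).map (theta hh k).toLinearMap
      = (laplacianH g h k).eigenspace lam) ∧
    (∀ lam : ℂ, Module.rank ℂ ((laplacianH g h k).eigenspace lam)
      = Module.rank ℂ ((laplacianMetric g h k).eigenspace lam)) := by
  have hconj : laplacianH g h k = (theta hh k).conj (laplacianMetric g h k) := by
    ext1 u
    rw [LinearEquiv.conj_apply_apply, theta_laplacianMetric, LinearEquiv.apply_symm_apply]
  have hmap : ∀ lam : ℂ, ((laplacianMetric g h k).eigenspace lam).map (theta hh k).toLinearMap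
      = (laplacianH g h k).eigenspace lam := fun lam => by
    rw [hconj, map_eigenspace_conj]
  refine ⟨formInnerRescaled_theta g hh, hconj, ?_, fun lam => ?_, hmap, fun lam => ?_⟩
  · rw [hconj]
    exact AlgEquiv.spectrum_eq (LinearEquiv.conjAlgEquiv ℂ (theta hh k)) (laplacianMetric g h k)
  · rw [Module.End.hasEigenvalue_iff, Module.End.hasEigenvalue_iff, ← hmap, ne_eq, ne_eq,
      Submodule.map_eq_bot_iff]
  · rw [← hmap]
    exact ((theta hh k).submoduleMap _).rank_eq.symm
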